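/- **Setting.** Let $d\ge 1$. Let $0<\mu_1\le\mu_2\le\cdots$ be real numbers, let $M_0>0$, and put $M_j:=M_0\mu_1\cdots\mu_j$ for $j\ge 1$. Let $K\subseteq\mathbb{R}^d$ be a convex body (convex, compact, with non-empty interior) of diameter $\delta_K$, and let $b>0$. Put $j_0:=\min\{j\in\mathbb{Z}_{\ge 0}: j\ge \log (M_0/b)\}$ and assume $$\sum_{j=j_0+1}^{\infty}\frac1{\mu_j}>\delta_K\, e$$ (the sum may be $\infty$); that is, $(M,K,2b)$ is *admissible data*. The *associated integer* is $$N:=1+\sup\Big\{n\in\mathbb{Z}_{\ge 0}:\ \sum_{j=j_0+1}^{n}\frac{1}{\delta_K\mu_j}<e\Big\},$$ which is finite. Let $\tilde\mu:[1,\infty)\to(0,\infty)$ be any increasing (i.e. non-decreasing), continuous, piecewise $\mathcal{C}^1$ function with $\tilde\mu(k)=\mu_k$ for all integers $k\ge 1$, and for $n\ge 1$ set $$\gamma_{\tilde\mu}(n):=\sup_{1\le s\le n}\frac{s\,\tilde\mu'(s)}{\tilde\mu(s)},\qquad \Gamma_{\tilde\mu}(n):=4e^{4+\gamma_{\tilde\mu}(n)},$$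 where $\tilde\mu'(s)$ is the left derivative at points $s>1$ at which $\tilde\mu$ is not differentiable, and the right derivative at $s=1$. For $N\ge 2$ put $C_N:=\Gamma_{\tilde\mu}(2(N-1))$. For a set $S$ write $\|f\|_S:=\sup_{x\in S}|f(x)|$. For an integer $n\ge 0$, a function $f:K\to\mathbb{R}$ is called *$M^{|n}$-smooth* on $K$ if it is of class $\mathcal{C}^n$ in an open neighbourhood of $K$ and $$\sum_{|\alpha|=j}\frac{j!}{\alpha!}\,\|f^{(\alpha)}\|_K\le M_j\qquad\text{for all } 0\le j\le n .$$ **Theorem.** Assume $N\ge 2$. Let $f:K\to\mathbb{R}$ be $M^{|2(N-1)}$-smooth on $K$, let $L\subseteq K$ be a convex body with $\|f\|_L\ge b$, and let $E\subseteq L$ be a Lebesgue measurable set with Lebesgue measure $|E|>0$. Then $$\|f\|_L\le\left(\frac{C_N\,|L|^{1/d}}{|L|^{1/d}-(|L|-|E|)^{1/d}}\right)^{2(N-1)}\|f\|_E .$$ (If $N=1$, the right-hand side is interpreted as $+\infty$ and nothing is claimed.) -/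

import Mathlib

open MeasureTheory

noncomputable section

namespace Remez

/-- A full admissible weight `M^{|∞}` all of whose members are finite: a positive increasing
sequence `μ_1 ≤ μ_2 ≤ ⋯` (the value `μ 0` is not used) together with a number `M_0 > 0`. -/
structure FullWeight where
  μ : ℕ → ℝ
  M0 : ℝ
  μ_pos : ∀ j, 1 ≤ j → 0 < μ j
  μ_mono : ∀ i j, 1 ≤ i → i ≤ j → μ i ≤ μ j
  M0_pos : 0 < M0

/-- `M_j = M_0 μ_1 ⋯ μ_j`. -/
def FullWeight.M (W : FullWeight) (j : ℕ) : ℝ := W.M0 * ∏ i ∈ Finset.Icc 1 j, W.μ i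

/-- A convex body in `ℝ^d`: convex, compact, with non-empty interior. -/
def IsConvexBody {d : ℕ} (K : Set (EuclideanSpace ℝ (Fin d))) : Prop :=
  Convex ℝ K ∧ IsCompact K ∧ (interior K).Nonempty

/-- The sup-norm `‖f‖_S = sup_{x ∈ S} |f x|`. -/
def supNorm {d : ℕ} (f : EuclideanSpace ℝ (Fin d) → ℝ) (S : Set (EuclideanSpace ℝ (Fin d))) : ℝ :=
  sSup ((fun x => |f x|) '' S)

/-- The partial derivative `f^{(α)}` of multi-index `α`: the derivative of order
`|α| = α_1 + ⋯ + α_d`, evaluated on the tuple that contains the basis vector `e_i`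
exactly `α_i` times. -/
def partialDeriv {d : ℕ} (α : Fin d → ℕ) (f : EuclideanSpace ℝ (Fin d) → ℝ)
    (x : EuclideanSpace ℝ (Fin d)) : ℝ :=
  iteratedFDeriv ℝ (∑ i, α i) f x
    (fun k => EuclideanSpace.single (finSigmaFinEquiv.symm k).1 (1 : ℝ))

/-- `‖f‖_{j,K} = ∑_{|α| = j} (j! / α!) ‖f^{(α)}‖_K`. -/
def derivNorm {d : ℕ} (j : ℕ) (f : EuclideanSpace ℝ (Fin d) → ℝ)
    (K : Set (EuclideanSpace ℝ (Fin d))) : ℝ :=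
  ∑ α ∈ Finset.piAntidiag (Finset.univ : Finset (Fin d)) j,
    ((j.factorial : ℝ) / ∏ i, ((α i).factorial : ℝ)) * supNorm (partialDeriv α f) K

/-- `f` is `M^{|n}`-smooth on `K`, where `M^{|n}` is the weight obtained from `M^{|∞}` by setting
all members of index greater than `n` equal to `∞` (for these the bound is void):
`f` is of class `C^n` in an open neighbourhood of `K` and `‖f‖_{j,K} ≤ M_j` for `0 ≤ j < n + 1`. -/
def FullWeight.IsSmooth (W : FullWeight) (n : ℕ∞) {d : ℕ}
    (K : Set (EuclideanSpace ℝ (Fin d))) (f : EuclideanSpace ℝ (Fin d) → ℝ) : Prop :=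
  (∃ U : Set (EuclideanSpace ℝ (Fin d)), IsOpen U ∧ K ⊆ U ∧ ContDiffOn ℝ n f U) ∧
    ∀ j : ℕ, (j : ℕ∞) ≤ n → derivNorm j f K ≤ W.M j

/-- `j_0(b)`, the smallest natural number `j ≥ log (b⁻¹)`. -/
def jZero (b : ℝ) : ℕ := ⌈Real.log b⁻¹⌉₊

/-- The `μ`-degree `sup {n ∈ ℕ : ∑_{j = j_0(b)+1}^n 1/μ_j < e}`, an element of `ℕ ∪ {∞}`. -/
def degree (μ : ℕ → ℝ) (b : ℝ) : ℕ∞ :=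
  sSup ((fun n : ℕ => (n : ℕ∞)) ''
    {n : ℕ | ∑ j ∈ Finset.Icc (jZero b + 1) n, 1 / μ j < Real.exp 1})

/-- `(M^{|∞}, K, b)` is admissible data: `K` is a convex body, `b > 0`, and
`∑_{j > j_0} 1/μ_j > δ_K e`, where `j_0 = j_0(b / (2 M_0))` and `δ_K` is the diameter of `K`.
The series may diverge, and is therefore summed in `[0, ∞]`. -/
def AdmissibleData (W : FullWeight) {d : ℕ} (K : Set (EuclideanSpace ℝ (Fin d))) (b : ℝ) : Prop :=
  IsConvexBody K ∧ 0 < b ∧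
    ENNReal.ofReal (Metric.diam K * Real.exp 1) <
      ∑' i : ℕ, ENNReal.ofReal (1 / W.μ (jZero (b / (2 * W.M0)) + 1 + i))

/-- `N` is the integer associated with the data `(M^{|∞}, K, b)`: it equals one plus the
`(δ_K μ)`-degree at `b / (2 M_0)`. For admissible data this degree is finite. -/
def IsAssociatedInteger (W : FullWeight) {d : ℕ} (K : Set (EuclideanSpace ℝ (Fin d))) (b : ℝ)
    (N : ℕ) : Prop :=
  (N : ℕ∞) = degree (fun j => Metric.diam K * W.μ j) (b / (2 * W.M0)) + 1

/-- `g` is piecewise `C^1` on `[1, ∞)`: there are `1 = a_0 < a_1 < ⋯ → ∞` such that `g` is `C^1`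
on every closed interval `[a_k, a_{k+1}]` (one-sided derivatives at its end points). -/
def PiecewiseC1 (g : ℝ → ℝ) : Prop :=
  ∃ a : ℕ → ℝ, a 0 = 1 ∧ StrictMono a ∧ Filter.Tendsto a Filter.atTop Filter.atTop ∧
    ∀ k, ContDiffOn ℝ 1 g (Set.Icc (a k) (a (k + 1)))

/-- `g` is an increasing, continuous, piecewise `C^1` function `[1, ∞) → (0, ∞)` with
`g k = μ_k` for all `k ≥ 1`. (Values of `g` outside `[1, ∞)` play no role.) -/
def FullWeight.IsInterpolation (W : FullWeight) (g : ℝ → ℝ) : Prop :=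
  MonotoneOn g (Set.Ici 1) ∧ ContinuousOn g (Set.Ici 1) ∧ (∀ s, 1 ≤ s → 0 < g s) ∧
    PiecewiseC1 g ∧ ∀ k : ℕ, 1 ≤ k → g k = W.μ k

/-- The derivative of a piecewise `C^1` function on `[1, ∞)`, with the convention that it is the
left derivative where the two one-sided derivatives differ; at the end point `1` of the domain it
is the right derivative. -/
def leftDeriv (g : ℝ → ℝ) (s : ℝ) : ℝ :=
  if s = 1 then derivWithin g (Set.Ici 1) 1 else derivWithin g (Set.Iic s) s

/-- `γ_g(n) = sup_{1 ≤ s ≤ n} s g'(s) / g(s)`. -/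
def gammaConst (g : ℝ → ℝ) (n : ℕ) : ℝ :=
  sSup ((fun s : ℝ => s * leftDeriv g s / g s) '' Set.Icc 1 (n : ℝ))

/-- `Γ_g(n) = 4 e^{4 + γ_g(n)}`. -/
def GammaConst (g : ℝ → ℝ) (n : ℕ) : ℝ := 4 * Real.exp (4 + gammaConst g n)

end Remez

end

/-! The problem is reduced to one variable at a point x₀ where |f| attains its maximum on L. In
polar coordinates about x₀, a set filling more than the fraction 1 - (1 - c)^d of L fills more than
the fraction c of the segment cut out by L on some ray from x₀: for a given length, the density
r^(d-1) gives most mass to the far end of the segment (`exists_ray`). The derivatives of f along the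
ray inherit the bounds M_j, because expanding (∑ v_i ∂_i)^j with |v_i| ≤ 1 produces exactly the
multinomial sum in the smoothness condition (`abs_iteratedFDeriv_le_derivNorm`).

On the ray, let F be the restriction of f and q = 2(N - 1). Interpolate F by a polynomial P at q
well separated nodes of the set where |F| ≤ ε. Rolle's theorem for F - P yields points x_0 ≤ ⋯ ≤
x_(q-1) with F^(j)(x_j) = P^(j)(x_j). If all these values were at most e^(j-q) M_j, Bang's estimate
(`bang_bound`) and the size of ∑ 1/μ_j would force |F(0)| < e^(-j₀) M_0 ≤ b, which is false. So for
some j the bound for P^(j) from Lagrange's formula, a multiple of ε, exceeds e^(j-q) M_j; solving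
for M_0 ≥ |F(0)| gives the inequality (`remez_one_dim`). The constant γ enters only through the
lower bound μ_i ≥ μ_q (i/q)^γ, which keeps the product μ_1⋯μ_j from being too small. -/

namespace Remez

/-! ### Rolle's theorem and Bang's estimate -/

/-- Between consecutive zeros of the successive derivatives of a function with `n + 1` zeros one
finds zeros of all derivatives up to order `n` that move to the right. -/
theorem exists_monotone_zeros_of_derivs (n : ℕ) : ∀ (G : ℕ → ℝ → ℝ) (z : ℕ → ℝ) {a b : ℝ},
    (∀ j < n, ∀ t ∈ Set.Icc a b, HasDerivAt (G j) (G (j + 1) t) t) →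
    (∀ i < n, z i < z (i + 1)) → (∀ i ≤ n, z i ∈ Set.Icc a b) → (∀ i ≤ n, G 0 (z i) = 0) →
    ∃ x : ℕ → ℝ, x 0 = z 0 ∧ (∀ j < n, x j ≤ x (j + 1)) ∧
      (∀ j ≤ n, x j ∈ Set.Icc (z 0) (z n)) ∧ ∀ j ≤ n, G j (x j) = 0 := by
  induction n with
  | zero =>
    intro G z a b _ _ _ h0
    exact ⟨fun _ => z 0, rfl, by simp, by simp, fun j hj => by
      obtain rfl : j = 0 := by omega
      exact h0 0 le_rfl⟩
  | succ n ih =>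
    intro G z a b hG hz hzab h0
    have rolle : ∀ i, ∃ c, i ≤ n → c ∈ Set.Ioo (z i) (z (i + 1)) ∧ G 1 c = 0 := by
      intro i
      by_cases hi : i ≤ n
      · have hsub : Set.Icc (z i) (z (i + 1)) ⊆ Set.Icc a b :=
          Set.Icc_subset_Icc (hzab i (by omega)).1 (hzab (i + 1) (by omega)).2
        obtain ⟨c, hc, hc0⟩ := exists_hasDerivAt_eq_zero (f := G 0) (f' := G 1)
          (hz i (by omega))
          (fun t ht => (hG 0 (by omega) t (hsub ht)).continuousAt.continuousWithinAt)
          (by rw [h0 i (by omega), h0 (i + 1) (by omega)])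
          (fun t ht => hG 0 (by omega) t (hsub (Set.Ioo_subset_Icc_self ht)))
        exact ⟨c, fun _ => ⟨hc, hc0⟩⟩
      · exact ⟨0, fun h => absurd h hi⟩
    choose c hc using rolle
    have hcab : ∀ i ≤ n, c i ∈ Set.Icc a b := fun i hi =>
      ⟨(hzab i (by omega)).1.trans (hc i hi).1.1.le,
        (hc i hi).1.2.le.trans (hzab (i + 1) (by omega)).2⟩
    obtain ⟨x, hx0, hxm, hxI, hxz⟩ := ih (fun j => G (j + 1)) c
      (fun j hj => hG (j + 1) (by omega))
      (fun i hi => (hc i (by omega)).1.2.trans (hc (i + 1) (by omega)).1.1) hcab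
      (fun i hi => (hc i hi).2)
    have hzc : z 0 < c 0 := (hc 0 (by omega)).1.1
    have hcz : c n < z (n + 1) := (hc n le_rfl).1.2
    -- The induction keeps the first point at the leftmost zero: the Rolle zeros start at c 0 > z 0,
    -- so prepending z 0 preserves monotonicity.
    refine ⟨fun j => Nat.casesOn j (z 0) x, rfl, ?_, ?_, ?_⟩
    · rintro (_ | j) hj
      · change z 0 ≤ x 0
        rw [hx0]; exact hzc.le
      · exact hxm j (by omega)
    · rintro (_ | j) hj
      · exact ⟨le_rfl, hzc.le.trans (((hxI 0 (by omega)).1.trans (hxI 0 (by omega)).2).trans hcz.le)⟩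
      · have := hxI j (by omega)
        exact ⟨hzc.le.trans this.1, this.2.trans hcz.le⟩
    · rintro (_ | j) hj
      · exact h0 0 (by omega)
      · exact hxz j (by omega)

/-- The product `M_0 ν_1 ⋯ ν_j`. -/
def weightProd (M0 : ℝ) (ν : ℕ → ℝ) (j : ℕ) : ℝ := M0 * ∏ i ∈ Finset.Icc 1 j, ν i

theorem weightProd_zero (M0 : ℝ) (ν : ℕ → ℝ) : weightProd M0 ν 0 = M0 := by simp [weightProd]

theorem weightProd_succ (M0 : ℝ) (ν : ℕ → ℝ) (j : ℕ) :
    weightProd M0 ν (j + 1) = weightProd M0 ν j * ν (j + 1) := by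
  simp [weightProd, Finset.prod_Icc_succ_top, mul_assoc]

theorem weightProd_pos {M0 : ℝ} {ν : ℕ → ℝ} {q : ℕ} (hM : 0 < M0)
    (hν : ∀ j, 1 ≤ j → j ≤ q → 0 < ν j) {j : ℕ} (hj : j ≤ q) : 0 < weightProd M0 ν j := by
  refine mul_pos hM (Finset.prod_pos fun i hi => ?_)
  rw [Finset.mem_Icc] at hi
  exact hν i hi.1 (hi.2.trans hj)

open Real in
/-- One step of Bang's argument: if at the point `c` the derivatives are below the level
`e^{-m}`, then this level grows at most like `exp (e ν_m (c - t))` to the left of `c`. -/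
theorem bang_step {D : ℕ → ℝ → ℝ} {ν : ℕ → ℝ} {M0 : ℝ} {q m : ℕ} {l c : ℝ} {x : ℕ → ℝ}
    (hM : 0 < M0) (hν : ∀ j, 1 ≤ j → j ≤ q → 0 < ν j)
    (hνm : ∀ i j, 1 ≤ i → i ≤ j → j ≤ q → ν i ≤ ν j)
    (hD : ∀ j < q, ∀ t ∈ Set.Icc 0 l, HasDerivAt (D j) (D (j + 1) t) t)
    (hDM : ∀ j ≤ q, ∀ t ∈ Set.Icc 0 l, |D j t| ≤ weightProd M0 ν j)
    (hx : ∀ j, j + 1 < q → x j ≤ x (j + 1))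
    (hDx : ∀ j < q, |D j (x j)| ≤ exp ((j : ℝ) - q) * weightProd M0 ν j)
    (hm1 : 1 ≤ m) (hmq : m ≤ q) (hcl : c ≤ l)
    (hc : ∀ j < m, c ≤ x j → |D j c| ≤ exp ((j : ℝ) - m) * weightProd M0 ν j) :
    ∀ i ≤ m, ∀ j, j + i = m → ∀ t ∈ Set.Icc 0 c, (j < m → t ≤ x j) →
      |D j t| ≤ exp ((j : ℝ) - m) * weightProd M0 ν j * exp (exp 1 * ν m * (c - t)) := by
  -- Downward induction on the order j = m - i. Order m is covered by the a priori bound; order j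
  -- follows from order j + 1 by moving left from min c (x j), where D j is small by `hc` or by
  -- `hDx`. Since x j ≤ x (j + 1), the bound for order j + 1 is available on the whole way.
  intro i
  induction i with
  | zero =>
    intro _ j hj t ht _
    obtain rfl : j = m := by omega
    rw [sub_self, exp_zero, one_mul]
    refine (hDM j hmq t ⟨ht.1, ht.2.trans hcl⟩).trans
      (le_mul_of_one_le_right (weightProd_pos hM hν hmq).le (one_le_exp ?_))
    exact mul_nonneg (mul_nonneg (exp_pos 1).le (hν j hm1 hmq).le) (by linarith [ht.2])
  | succ i ih =>
    intro him j hj t ht htx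
    have hjm : j < m := by omega
    have htx := htx hjm
    have hνpos : 0 < ν m := hν m (by omega) hmq
    have hWpos : 0 < weightProd M0 ν j := weightProd_pos hM hν (by omega)
    set A : ℝ := exp ((j : ℝ) - m) * weightProd M0 ν j with hA
    have hApos : 0 < A := mul_pos (exp_pos _) hWpos
    set H : ℝ → ℝ := fun s => A * exp (exp 1 * ν m * (c - s)) with hH
    set s0 := min c (x j) with hs0
    have hts0 : t ≤ s0 := le_min ht.2 htx
    have hs0l : s0 ≤ l := (min_le_left _ _).trans hcl
    have hHd : ∀ s, HasDerivAt H (-(exp 1 * ν m) * H s) s := by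
      intro s
      have h1 : HasDerivAt (fun s : ℝ => exp 1 * ν m * (c - s)) (exp 1 * ν m * (-1)) s :=
        ((hasDerivAt_id s).const_sub c).const_mul _
      convert! h1.exp.const_mul A using 1
      simp only [hH]; ring
    have hend : |D j s0| ≤ H s0 := by
      have h1 : |D j s0| ≤ A := by
        rcases le_total c (x j) with h | h
        · rw [hs0, min_eq_left h]; exact hc j hjm h
        · rw [hs0, min_eq_right h]
          refine (hDx j (by omega)).trans ?_
          rw [hA]
          gcongr
      refine h1.trans (le_mul_of_one_le_right hApos.le (one_le_exp ?_))
      exact mul_nonneg (by positivity) (by linarith [min_le_left c (x j)])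
    have hder : ∀ s ∈ Set.Icc t s0, |D (j + 1) s| ≤ exp 1 * ν m * H s := by
      intro s hs
      have h1 := ih (by omega) (j + 1) (by omega) s ⟨ht.1.trans hs.1, hs.2.trans (min_le_left _ _)⟩
        (fun h => (hs.2.trans (min_le_right _ _)).trans (hx j (by omega)))
      refine h1.trans ?_
      have h2 : ν (j + 1) ≤ ν m := hνm _ _ (by omega) (by omega) hmq
      have h3 : exp (((j + 1 : ℕ) : ℝ) - m) = exp 1 * exp ((j : ℝ) - m) := by
        rw [← exp_add]; congr 1; push_cast; ring
      rw [h3, weightProd_succ]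
      calc _ = exp 1 * ν (j + 1) * H s := by simp only [hH, hA]; ring
        _ ≤ _ := by
          have : 0 ≤ H s := by positivity
          gcongr
    -- The majorant H solves H' = -e ν_m H, so the bound on D (j + 1) makes H - σ D j decreasing;
    -- being nonnegative at s0, it is nonnegative at t.
    have key : ∀ σ : ℝ, (σ = 1 ∨ σ = -1) → σ * D j t ≤ H t := by
      intro σ hσ
      have habs : ∀ y : ℝ, |σ * y| = |y| := by
        intro y; rcases hσ with rfl | rfl <;> simp
      have hd : ∀ s ∈ Set.Icc t s0, HasDerivAt (fun s => H s - σ * D j s)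
          (-(exp 1 * ν m) * H s - σ * D (j + 1) s) s := fun s hs =>
        (hHd s).sub ((hD j (by omega) s ⟨ht.1.trans hs.1, hs.2.trans hs0l⟩).const_mul σ)
      have hanti : AntitoneOn (fun s => H s - σ * D j s) (Set.Icc t s0) := by
        refine antitoneOn_of_deriv_nonpos (convex_Icc _ _)
          (fun s hs => (hd s hs).continuousAt.continuousWithinAt)
          (fun s hs => (hd s (interior_subset hs)).differentiableAt.differentiableWithinAt)
          (fun s hs => ?_)
        rw [(hd s (interior_subset hs)).deriv]
        have h1 := hder s (interior_subset hs)
        have h2 := neg_abs_le (σ * D (j + 1) s)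
        rw [habs] at h2
        linarith
      have h1 := hanti ⟨le_rfl, hts0⟩ ⟨hts0, le_rfl⟩ hts0
      have h2 := le_abs_self (σ * D j s0)
      rw [habs] at h2
      simp only at h1
      linarith
    have k1 := key 1 (Or.inl rfl)
    have k2 := key (-1) (Or.inr rfl)
    exact abs_le.2 ⟨by linarith, by linarith⟩

open Real in
/-- Bang's estimate: if the derivatives of order `j < q` are small at points `x_j` that move to the
right, and the series of the `1/ν_j` is long compared to the interval, then the function is small
at the left end point. -/
theorem bang_bound {D : ℕ → ℝ → ℝ} {ν : ℕ → ℝ} {M0 : ℝ} {q j0 : ℕ} {l : ℝ} {x : ℕ → ℝ}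
    (hM : 0 < M0) (hν : ∀ j, 1 ≤ j → j ≤ q → 0 < ν j)
    (hνm : ∀ i j, 1 ≤ i → i ≤ j → j ≤ q → ν i ≤ ν j)
    (hD : ∀ j < q, ∀ t ∈ Set.Icc 0 l, HasDerivAt (D j) (D (j + 1) t) t)
    (hDM : ∀ j ≤ q, ∀ t ∈ Set.Icc 0 l, |D j t| ≤ weightProd M0 ν j)
    (hx : ∀ j, j + 1 < q → x j ≤ x (j + 1))
    (hx0 : 0 ≤ x 0) (hxl : ∀ j < q, x j ≤ l)
    (hDx : ∀ j < q, |D j (x j)| ≤ exp ((j : ℝ) - q) * weightProd M0 ν j)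
    (hj0 : j0 < q) (hsum : exp 1 * l < ∑ i ∈ Finset.Ioc j0 q, 1 / ν i) :
    |D 0 0| < exp (-(j0 : ℝ)) * M0 := by
  have hl : 0 ≤ l := hx0.trans (hxl 0 (by omega))
  -- The gap from c m to c (m + 1) has length 1/(e ν_(m+1)), over which the exponential of
  -- `bang_step` grows by the factor e: exactly the loss from level e^(-(m+1)) to level e^(-m).
  set c : ℕ → ℝ := fun m => l - ∑ i ∈ Finset.Ioc m q, 1 / (exp 1 * ν i) with hc
  have hcsucc : ∀ m, m < q → c m = c (m + 1) - 1 / (exp 1 * ν (m + 1)) := by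
    intro m hm
    have : Finset.Ioc m q = insert (m + 1) (Finset.Ioc (m + 1) q) := by
      ext a; simp only [Finset.mem_Ioc, Finset.mem_insert]; omega
    simp only [hc]
    rw [this, Finset.sum_insert (by simp)]
    ring
  have hcle : ∀ m ≤ q, c m ≤ l := by
    intro m hm
    have : 0 ≤ ∑ i ∈ Finset.Ioc m q, 1 / (exp 1 * ν i) := Finset.sum_nonneg fun i hi => by
      rw [Finset.mem_Ioc] at hi
      have := hν i (by omega) hi.2
      positivity
    simp only [hc]; linarith
  have main : ∀ i, i ≤ q → ∀ m, m + i = q → ∀ t ∈ Set.Icc 0 l, c m ≤ t → ∀ j < q, t ≤ x j →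
      |D j t| ≤ exp ((j : ℝ) - m) * weightProd M0 ν j := by
    intro i
    induction i with
    | zero =>
      intro _ m hm t ht hct j hj htx
      obtain rfl : m = q := by omega
      have h1 : c m = l := by simp [hc]
      have h2 : t = x j := le_antisymm htx ((hxl j hj).trans (h1 ▸ hct))
      rw [h2]; exact hDx j hj
    | succ i ih =>
      intro hi m hm t ht hct j hj htx
      have hW : 0 < weightProd M0 ν j := weightProd_pos hM hν hj.le
      rcases le_or_gt m j with hmj | hjm
      · refine (hDM j hj.le t ht).trans (le_mul_of_one_le_left hW.le (one_le_exp ?_))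
        have : (m : ℝ) ≤ j := by exact_mod_cast hmj
        linarith
      have ih := ih (by omega) (m + 1) (by omega)
      rcases le_or_gt (c (m + 1)) t with h | h
      · refine (ih t ht h j hj htx).trans ?_
        gcongr
        linarith
      · have hνp : 0 < ν (m + 1) := hν _ (by omega) (by omega)
        have hcm : c (m + 1) ∈ Set.Icc 0 l := ⟨ht.1.trans h.le, hcle _ (by omega)⟩
        have h1 := bang_step (m := m + 1) (c := c (m + 1)) hM hν hνm hD hDM hx hDx (by omega)
          (by omega) (hcle _ (by omega)) (fun j hj hjx => ih _ hcm le_rfl j (by omega) hjx)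
          (m + 1 - j) (by omega) j (by omega) t ⟨ht.1, h.le⟩ (fun _ => htx)
        refine h1.trans ?_
        have h2 : exp 1 * ν (m + 1) * (c (m + 1) - t) ≤ 1 := by
          have h3 : c (m + 1) - t ≤ 1 / (exp 1 * ν (m + 1)) := by
            rw [hcsucc m (by omega)] at hct; linarith
          calc _ ≤ exp 1 * ν (m + 1) * (1 / (exp 1 * ν (m + 1))) := by gcongr
            _ = 1 := by field_simp
        calc _ ≤ exp ((j : ℝ) - (m + 1 : ℕ)) * weightProd M0 ν j * exp 1 := by gcongr
          _ = exp ((j : ℝ) - (m + 1 : ℕ)) * exp 1 * weightProd M0 ν j := by ring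
          _ = _ := by rw [← exp_add]; congr 2; push_cast; ring
  have hq1 := main (q - (j0 + 1)) (by omega) (j0 + 1) (by omega)
  -- The strict sum condition puts c j0 to the left of 0. Hence 0 is either beyond c (j0 + 1) or
  -- strictly inside the last gap, where the loss is strictly less than e.
  have hcneg : c j0 < 0 := by
    have : ∑ i ∈ Finset.Ioc j0 q, 1 / (exp 1 * ν i) =
        (exp 1)⁻¹ * ∑ i ∈ Finset.Ioc j0 q, 1 / ν i := by
      rw [Finset.mul_sum]
      exact Finset.sum_congr rfl fun i _ => by rw [one_div, mul_inv, one_div]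
    simp only [hc, this]
    have h2 : l < (exp 1)⁻¹ * ∑ i ∈ Finset.Ioc j0 q, 1 / ν i := by
      rw [lt_inv_mul_iff₀ (exp_pos 1)]; exact hsum
    linarith
  have hW0 := weightProd_zero M0 ν
  have e1 : exp (-(j0 : ℝ)) = exp (((0 : ℕ) : ℝ) - (j0 + 1 : ℕ)) * exp 1 := by
    rw [← exp_add]; congr 1; push_cast; ring
  rcases le_or_gt (c (j0 + 1)) 0 with h | h
  · have h1 := hq1 0 ⟨le_rfl, hl⟩ h 0 (by omega) hx0
    rw [hW0] at h1
    refine h1.trans_lt ?_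
    gcongr
    push_cast; linarith
  · have hνp : 0 < ν (j0 + 1) := hν _ (by omega) (by omega)
    have h1 := bang_step (m := j0 + 1) (c := c (j0 + 1)) hM hν hνm hD hDM hx hDx (by omega)
      (by omega) (hcle _ (by omega))
      (fun j hj hjx => hq1 _ ⟨h.le, hcle _ (by omega)⟩ le_rfl j (by omega) hjx)
      (j0 + 1) le_rfl 0 (by omega) 0 ⟨le_rfl, h.le⟩ (fun _ => hx0)
    refine h1.trans_lt ?_
    rw [hW0, e1]
    have h2 : exp 1 * ν (j0 + 1) * (c (j0 + 1) - 0) < 1 := by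
      have h3 : c (j0 + 1) - 0 < 1 / (exp 1 * ν (j0 + 1)) := by
        rw [hcsucc j0 hj0] at hcneg; linarith
      calc _ < exp 1 * ν (j0 + 1) * (1 / (exp 1 * ν (j0 + 1))) := by gcongr
        _ = 1 := by field_simp
    calc _ < exp (((0 : ℕ) : ℝ) - (j0 + 1 : ℕ)) * M0 * exp 1 := by gcongr
      _ = _ := by ring

/-! ### Interpolation at separated nodes -/

/-- A set of outer measure larger than `k s` contains `k + 1` points with gaps at least `s`. -/
theorem exists_separated_points (k : ℕ) : ∀ (A : Set ℝ) (s : ℝ), 0 < s → BddBelow A →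
    ENNReal.ofReal (k * s) < volume A →
    ∃ z : ℕ → ℝ, (∀ i ≤ k, z i ∈ A) ∧ ∀ i < k, z i + s ≤ z (i + 1) := by
  induction k with
  | zero =>
    intro A s _ _ hA
    obtain ⟨y, hy⟩ := nonempty_of_measure_ne_zero (ne_bot_of_gt hA)
    exact ⟨fun _ => y, fun _ _ => hy, by simp⟩
  | succ k ih =>
    intro A s hs hbdd hA
    have hne : A.Nonempty := nonempty_of_measure_ne_zero (ne_bot_of_gt hA)
    obtain ⟨r, hr1, hr2⟩ := ENNReal.lt_iff_exists_real_btwn.1 hA |>.imp fun r h => h.2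
    have hr : ((k + 1 : ℕ) : ℝ) * s < r := (ENNReal.ofReal_lt_ofReal_iff_of_nonneg (by positivity)).1 hr1
    push_cast at hr
    set η := r - (k + 1) * s with hη
    have hηpos : 0 < η := by linarith
    -- The infimum need not belong to A. A point within the slack η of it suffices: discarding
    -- everything below y + s costs less than s + η, so more than k s remains.
    obtain ⟨y, hyA, hy⟩ := exists_lt_of_csInf_lt hne (lt_add_of_pos_right (sInf A) hηpos)
    set A' := A ∩ Set.Ici (y + s) with hA'
    have hcover : A ⊆ A' ∪ Set.Icc (sInf A) (y + s) := by
      intro t ht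
      rcases le_total (y + s) t with h | h
      · exact Or.inl ⟨ht, h⟩
      · exact Or.inr ⟨csInf_le hbdd ht, h⟩
    have hA'm : ENNReal.ofReal (k * s) < volume A' := by
      by_contra hcon
      push Not at hcon
      have h1 : volume A ≤ ENNReal.ofReal (k * s) + ENNReal.ofReal (y + s - sInf A) := by
        refine (measure_mono hcover).trans ((measure_union_le _ _).trans ?_)
        rw [Real.volume_Icc]
        gcongr
      rw [← ENNReal.ofReal_add (by positivity) (by linarith [csInf_le hbdd hyA])] at h1
      have h2 := hr2.trans_le h1
      have h3 := (ENNReal.ofReal_lt_ofReal_iff_of_nonneg (by nlinarith [hs.le, (Nat.cast_nonneg k : (0:ℝ) ≤ k)])).1 h2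
      linarith
    obtain ⟨z, hzA, hzs⟩ := ih A' s hs (hbdd.mono Set.inter_subset_left) hA'm
    refine ⟨fun i => Nat.casesOn i y z, ?_, ?_⟩
    · rintro (_ | i) hi
      · exact hyA
      · exact (hzA i (by omega)).1
    · rintro (_ | i) hi
      · exact (hzA 0 (by omega)).2
      · exact hzs i (by omega)

open Polynomial in
/-- Bound for the derivatives of a product of linear factors with roots in `[0, l]`. -/
theorem abs_eval_iterate_derivative_prod_le {S : Finset ℝ} {l t : ℝ} {k : ℕ} (hk : k ≤ S.card)
    (hS : ∀ a ∈ S, a ∈ Set.Icc 0 l) (ht : t ∈ Set.Icc 0 l) :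
    |(derivative^[k] (∏ a ∈ S, (X - C a))).eval t| ≤
      (S.card.factorial / (S.card - k).factorial : ℝ) * l ^ (S.card - k) := by
  rw [iterate_derivative_prod_X_sub_C hk, eval_mul, eval_natCast, eval_finsetSum, abs_mul,
    Nat.abs_cast]
  have h1 : ∀ T ∈ S.powersetCard (S.card - k), |(∏ a ∈ T, (X - C a)).eval t| ≤
      l ^ (S.card - k) := by
    intro T hT
    rw [Finset.mem_powersetCard] at hT
    rw [eval_prod, Finset.abs_prod, ← hT.2]
    rw [← Finset.prod_const]
    refine Finset.prod_le_prod (fun _ _ => abs_nonneg _) fun a ha => ?_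
    have := hS a (hT.1 ha)
    simp only [eval_sub, eval_X, eval_C]
    exact abs_le.2 ⟨by linarith [ht.1, this.2], by linarith [ht.2, this.1]⟩
  have h2 : |∑ T ∈ S.powersetCard (S.card - k), (∏ a ∈ T, (X - C a)).eval t| ≤
      (S.card.choose k : ℝ) * l ^ (S.card - k) := by
    refine (Finset.abs_sum_le_sum_abs _ _).trans ((Finset.sum_le_card_nsmul _ _ _ h1).trans ?_)
    rw [Finset.card_powersetCard, nsmul_eq_mul, Nat.choose_symm hk]
  calc _ ≤ (k.factorial : ℝ) * ((S.card.choose k : ℝ) * l ^ (S.card - k)) := by gcongr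
    _ = _ := by
      have := Nat.choose_mul_factorial_mul_factorial hk
      have h3 : ((S.card.choose k : ℝ) * k.factorial * (S.card - k).factorial) =
        S.card.factorial := by exact_mod_cast this
      have h4 : ((S.card - k).factorial : ℝ) ≠ 0 := by positivity
      rw [← h3]; field_simp

theorem gap_mul_le {z : ℕ → ℝ} {s : ℝ} {r : ℕ} (hz : ∀ i < r, z i + s ≤ z (i + 1)) {i j : ℕ}
    (hij : i ≤ j) (hj : j ≤ r) : (j - i : ℝ) * s ≤ z j - z i := by
  induction j, hij using Nat.le_induction with
  | base => simp
  | succ j hij ih =>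
    have h1 := ih (by omega)
    have h2 := hz j (by omega)
    push_cast; linarith

/-- The product of the distances of a node of an `s`-separated family to the others. -/
theorem prod_abs_sub_ge {z : ℕ → ℝ} {s : ℝ} {r : ℕ} (hs : 0 < s)
    (hz : ∀ i < r, z i + s ≤ z (i + 1)) {i : ℕ} (hi : i ≤ r) :
    (i.factorial * (r - i).factorial : ℝ) * s ^ r ≤
      ∏ j ∈ (Finset.range (r + 1)).erase i, |z i - z j| := by
  -- The nodes on the left are at distances at least s, 2s, …, i s, and similarly on the right.
  have hsplit : (Finset.range (r + 1)).erase i = Finset.range i ∪ Finset.Ioc i r := by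
    ext a; simp only [Finset.mem_erase, Finset.mem_range, Finset.mem_union, Finset.mem_Ioc]; omega
  have hdisj : Disjoint (Finset.range i) (Finset.Ioc i r) := by
    rw [Finset.disjoint_left]; intro a; simp only [Finset.mem_range, Finset.mem_Ioc]; omega
  rw [hsplit, Finset.prod_union hdisj]
  have h1 : (i.factorial : ℝ) * s ^ i ≤ ∏ j ∈ Finset.range i, |z i - z j| := by
    have : (i.factorial : ℝ) * s ^ i = ∏ j ∈ Finset.range i, ((i - j : ℝ) * s) := by
      rw [Finset.prod_mul_distrib, Finset.prod_const, Finset.card_range]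
      congr 1
      rw [← Finset.prod_range_add_one_eq_factorial, ← Finset.prod_range_reflect]
      push_cast
      refine Finset.prod_congr rfl fun j hj => ?_
      rw [Finset.mem_range] at hj
      rw [Nat.cast_sub (by omega), Nat.cast_sub (by omega)]; push_cast; ring
    rw [this]
    refine Finset.prod_le_prod (fun j hj => ?_) (fun j hj => ?_)
    · rw [Finset.mem_range] at hj
      have : (j : ℝ) ≤ i := by exact_mod_cast hj.le
      exact mul_nonneg (by linarith) hs.le
    · rw [Finset.mem_range] at hj
      exact (gap_mul_le hz hj.le hi).trans (le_abs_self _)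
  have h2 : ((r - i).factorial : ℝ) * s ^ (r - i) ≤ ∏ j ∈ Finset.Ioc i r, |z i - z j| := by
    have : ((r - i).factorial : ℝ) * s ^ (r - i) = ∏ j ∈ Finset.Ioc i r, ((j - i : ℝ) * s) := by
      rw [Finset.prod_mul_distrib, Finset.prod_const, Nat.card_Ioc]
      congr 1
      have h3 : Finset.Ioc i r = Finset.Ico (i + 1) (r + 1) := by
        ext a; simp only [Finset.mem_Ioc, Finset.mem_Ico]; omega
      rw [h3, Finset.prod_Ico_eq_prod_range, ← Finset.prod_range_add_one_eq_factorial,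
        show r + 1 - (i + 1) = r - i by omega]
      push_cast
      exact Finset.prod_congr rfl fun j _ => by ring
    rw [this]
    refine Finset.prod_le_prod (fun j hj => ?_) (fun j hj => ?_)
    · rw [Finset.mem_Ioc] at hj
      have : (i : ℝ) ≤ j := by exact_mod_cast hj.1.le
      exact mul_nonneg (by linarith) hs.le
    · rw [Finset.mem_Ioc] at hj
      rw [abs_sub_comm]
      exact (gap_mul_le hz hj.1.le hj.2).trans (le_abs_self _)
  calc _ = (i.factorial * s ^ i : ℝ) * ((r - i).factorial * s ^ (r - i)) := by
        have : s ^ r = s ^ i * s ^ (r - i) := by rw [← pow_add]; congr 1; omega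
        rw [this]; ring
    _ ≤ _ := by gcongr

open Polynomial in
/-- Bound for the derivatives of the Lagrange interpolation polynomial at separated nodes. -/
theorem abs_eval_iterate_derivative_interpolate_le {z w : ℕ → ℝ} {s ε l t : ℝ} {r k : ℕ}
    (hs : 0 < s) (hz : ∀ i < r, z i + s ≤ z (i + 1)) (hzl : ∀ i ≤ r, z i ∈ Set.Icc 0 l)
    (hw : ∀ i ≤ r, |w i| ≤ ε) (hk : k ≤ r) (ht : t ∈ Set.Icc 0 l) :
    |(derivative^[k] (Lagrange.interpolate (Finset.range (r + 1)) z w)).eval t| ≤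
      ε * (2 / s) ^ r * l ^ (r - k) / (r - k).factorial := by
  have hl : 0 ≤ l := ht.1.trans ht.2
  have hε : 0 ≤ ε := (abs_nonneg _).trans (hw 0 (by omega))
  have hinj : ∀ i ≤ r, ∀ j ≤ r, z i = z j → i = j := by
    intro i hi j hj h
    rcases lt_trichotomy i j with h1 | h1 | h1
    · have h2 := gap_mul_le hz h1.le hj
      have : (i : ℝ) < j := by exact_mod_cast h1
      nlinarith
    · exact h1
    · have h2 := gap_mul_le hz h1.le hi
      have : (j : ℝ) < i := by exact_mod_cast h1
      nlinarith
  have hbasis : ∀ i ≤ r, |(derivative^[k] (Lagrange.basis (Finset.range (r + 1)) z i)).eval t| ≤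
      (r.choose i : ℝ) * ((1 / s) ^ r * l ^ (r - k) / (r - k).factorial) := by
    intro i hi
    have h1 : Lagrange.basis (Finset.range (r + 1)) z i =
        C (∏ j ∈ (Finset.range (r + 1)).erase i, (z i - z j)⁻¹) *
          ∏ a ∈ ((Finset.range (r + 1)).erase i).image z, (X - C a) := by
      rw [Finset.prod_image, map_prod, ← Finset.prod_mul_distrib]
      · rfl
      · intro a ha b hb
        simp only [Finset.coe_erase, Set.mem_sdiff, Finset.mem_coe, Finset.mem_range] at ha hb
        exact hinj a (by omega) b (by omega)
    have hcard : (((Finset.range (r + 1)).erase i).image z).card = r := by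
      rw [Finset.card_image_of_injOn, Finset.card_erase_of_mem (by simp; omega), Finset.card_range]
      · omega
      · intro a ha b hb
        simp only [Finset.coe_erase, Set.mem_sdiff, Finset.mem_coe, Finset.mem_range] at ha hb
        exact hinj a (by omega) b (by omega)
    have h2 := abs_eval_iterate_derivative_prod_le (S := ((Finset.range (r + 1)).erase i).image z)
      (k := k) (l := l) (t := t) (by omega) (by
        intro a ha
        simp only [Finset.mem_image, Finset.mem_erase, Finset.mem_range] at ha
        obtain ⟨b, hb, rfl⟩ := ha
        exact hzl b (by omega)) ht
    rw [hcard] at h2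
    rw [h1, iterate_derivative_C_mul, eval_mul, eval_C, abs_mul, Finset.abs_prod]
    simp only [abs_inv]
    rw [Finset.prod_inv_distrib]
    have h3 := prod_abs_sub_ge hs hz hi
    have h4 : (0 : ℝ) < (i.factorial * (r - i).factorial : ℝ) * s ^ r := by positivity
    -- The r! from differentiating the numerator against i! (r - i)! in the denominator leaves a
    -- binomial coefficient; these sum to 2^r below.
    calc _ ≤ ((i.factorial * (r - i).factorial : ℝ) * s ^ r)⁻¹ *
          ((r.factorial / (r - k).factorial : ℝ) * l ^ (r - k)) := by gcongr
      _ = _ := by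
        have h5 : ((r.choose i : ℝ) * i.factorial * (r - i).factorial) = r.factorial := by
          exact_mod_cast Nat.choose_mul_factorial_mul_factorial hi
        rw [← h5, one_div, inv_pow]
        field_simp
  rw [Lagrange.interpolate_apply, iterate_derivative_sum, eval_finsetSum]
  refine (Finset.abs_sum_le_sum_abs _ _).trans ?_
  calc _ ≤ ∑ i ∈ Finset.range (r + 1),
        ε * ((r.choose i : ℝ) * ((1 / s) ^ r * l ^ (r - k) / (r - k).factorial)) := by
        refine Finset.sum_le_sum fun i hi => ?_
        rw [Finset.mem_range] at hi
        rw [iterate_derivative_C_mul, eval_mul, eval_C, abs_mul]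
        exact mul_le_mul (hw i (by omega)) (hbasis i (by omega)) (abs_nonneg _) hε
    _ = _ := by
      rw [← Finset.mul_sum, ← Finset.sum_mul, ← Nat.cast_sum, Nat.sum_range_choose]
      push_cast
      rw [div_pow, div_pow]; ring

/-! ### The one-dimensional Remez inequality -/

open Real Polynomial in
/-- A function that is small on a large set, but not at the left end point of the interval,
violates one of the bounds that the smallness of its interpolation polynomial would give. -/
theorem exists_weight_lt_of_small_on {D : ℕ → ℝ → ℝ} {ν : ℕ → ℝ} {M0 l s ε : ℝ} {r j0 : ℕ}
    {A : Set ℝ} (hM : 0 < M0) (hν : ∀ j, 1 ≤ j → j ≤ r + 1 → 0 < ν j)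
    (hνm : ∀ i j, 1 ≤ i → i ≤ j → j ≤ r + 1 → ν i ≤ ν j)
    (hD : ∀ j < r + 1, ∀ t ∈ Set.Icc 0 l, HasDerivAt (D j) (D (j + 1) t) t)
    (hDM : ∀ j ≤ r + 1, ∀ t ∈ Set.Icc 0 l, |D j t| ≤ weightProd M0 ν j)
    (hj0 : j0 < r + 1) (hsum : exp 1 * l ≤ ∑ i ∈ Finset.Ioc j0 (r + 1), 1 / ν i)
    (h0 : exp (-(j0 : ℝ)) * M0 ≤ |D 0 0|)
    (hA : A ⊆ Set.Ico 0 l) (hs : 0 < s) (hAs : ENNReal.ofReal (r * s) < volume A)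
    (hε : ∀ t ∈ A, |D 0 t| ≤ ε) :
    ∃ j ≤ r, exp ((j : ℝ) - (r + 1 : ℕ)) * weightProd M0 ν j <
      ε * (2 / s) ^ r * l ^ (r - j) / (r - j).factorial := by
  by_contra! hcon
  obtain ⟨z, hzA, hzs⟩ := exists_separated_points r A s hs ⟨0, fun t ht => (hA ht).1⟩ hAs
  have hzl : ∀ i ≤ r, z i ∈ Set.Icc 0 l := fun i hi => Set.Ico_subset_Icc_self (hA (hzA i hi))
  -- All nodes lie strictly left of l, so working on [0, z r] turns the weak sum condition into the
  -- strict one needed by `bang_bound`.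
  have hlt : z r < l := (hA (hzA r le_rfl)).2
  set P := Lagrange.interpolate (Finset.range (r + 1)) z (fun i => D 0 (z i)) with hP
  have hPb : ∀ j ≤ r, ∀ t ∈ Set.Icc 0 l, |(derivative^[j] P).eval t| ≤
      ε * (2 / s) ^ r * l ^ (r - j) / (r - j).factorial := fun j hj t ht =>
    abs_eval_iterate_derivative_interpolate_le hs hzs hzl (fun i hi => hε _ (hzA i hi)) hj ht
  have hzmono : ∀ i < r, z i < z (i + 1) := fun i hi => by linarith [hzs i hi]
  have hinj : Set.InjOn z (Finset.range (r + 1)) := by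
    have : ∀ i j, i < j → j ≤ r → z i < z j := fun i j hij hj => by
      have h1 := gap_mul_le hzs hij.le hj
      have h2 : (i : ℝ) < j := by exact_mod_cast hij
      nlinarith
    intro a ha b hb hab
    simp only [Finset.coe_range, Set.mem_Iio] at ha hb
    rcases lt_trichotomy a b with h | h | h
    · exact absurd hab (this a b h (by omega)).ne
    · exact h
    · exact absurd hab (this b a h (by omega)).ne'
  obtain ⟨x, hx0, hxm, hxI, hxz⟩ := exists_monotone_zeros_of_derivs r
    (fun j t => D j t - (derivative^[j] P).eval t) z (a := 0) (b := l)
    (fun j hj t ht => by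
      simp only [Function.iterate_succ_apply']
      exact (hD j (by omega) t ht).sub (Polynomial.hasDerivAt _ t))
    hzmono hzl (fun i hi => by
      simp only [Function.iterate_zero, id]
      rw [hP, Lagrange.eval_interpolate_at_node _ hinj (Finset.mem_range.2 (by omega)), sub_self])
  have hz0 : 0 ≤ z 0 := (hzl 0 (by omega)).1
  have hlt' := bang_bound (l := z r) (x := x) (q := r + 1) (j0 := j0) hM hν hνm
    (fun j hj t ht => hD j hj t ⟨ht.1, ht.2.trans hlt.le⟩)
    (fun j hj t ht => hDM j hj t ⟨ht.1, ht.2.trans hlt.le⟩)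
    (fun j hj => hxm j (by omega)) (hx0 ▸ hz0) (fun j hj => (hxI j (by omega)).2)
    (fun j hj => by
      have h1 := hxz j (by omega)
      rw [sub_eq_zero] at h1
      have h2 := hxI j (by omega)
      rw [h1]
      exact (hPb j (by omega) _ ⟨hz0.trans h2.1, h2.2.trans hlt.le⟩).trans (hcon j (by omega)))
    hj0 (lt_of_lt_of_le (by gcongr) hsum)
  exact absurd h0 (not_le.2 hlt')

open Real in
/-- Lower bound for products of a weight that is not much smaller than a power weight. -/
theorem prod_weight_ge {μ : ℕ → ℝ} {q j : ℕ} {c γ : ℝ} (hc : 0 ≤ c) (hγ : 0 ≤ γ) (hcq : c ≤ μ q)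
    (hμγ : ∀ i, 1 ≤ i → i ≤ q → μ q * ((i : ℝ) / q) ^ γ ≤ μ i) (hj : j ≤ q) :
    c ^ j * exp (-(γ * q)) ≤ ∏ i ∈ Finset.Icc 1 j, μ i := by
  rcases Nat.eq_zero_or_pos q with rfl | hq
  · obtain rfl : j = 0 := by omega
    simp
  have hq' : (0 : ℝ) < q := by exact_mod_cast hq
  have h1 : ∏ i ∈ Finset.Icc 1 j, (c * ((i : ℝ) / q) ^ γ) ≤ ∏ i ∈ Finset.Icc 1 j, μ i := by
    refine Finset.prod_le_prod (fun i _ => by positivity) (fun i hi => ?_)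
    rw [Finset.mem_Icc] at hi
    refine le_trans ?_ (hμγ i hi.1 (hi.2.trans hj))
    gcongr
  refine le_trans ?_ h1
  rw [Finset.prod_mul_distrib, Finset.prod_const, Nat.card_Icc, Nat.add_sub_cancel,
    Real.finsetProd_rpow _ _ (fun i _ => by positivity)]
  gcongr
  rw [Finset.prod_div_distrib, Finset.prod_const, Nat.card_Icc, Nat.add_sub_cancel,
    ← Nat.cast_prod, ← Finset.Ico_add_one_right_eq_Icc, Finset.prod_Ico_id_eq_factorial]
  -- The product of the i/q for i ≤ j is j!/q^j, and q^j/j! is one term of the series of e^q.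
  have h2 : exp (-(q : ℝ)) ≤ (j.factorial : ℝ) / q ^ j := by
    rw [exp_neg, ← inv_div]
    gcongr
    exact Real.pow_div_factorial_le_exp _ hq'.le j
  calc exp (-(γ * q)) = exp (-(q : ℝ)) ^ γ := by rw [← exp_mul]; congr 1; ring
    _ ≤ _ := by gcongr

open Real in
/-- The one-dimensional Remez inequality, at an end point of the interval. -/
theorem remez_one_dim {D : ℕ → ℝ → ℝ} {μ : ℕ → ℝ} {M0 l m ε γ : ℝ} {n j0 : ℕ} {A : Set ℝ}
    (hn : 1 ≤ n) (hM : 0 < M0) (hμ : ∀ j, 1 ≤ j → 0 < μ j) (hμm : ∀ i j, 1 ≤ i → i ≤ j → μ i ≤ μ j)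
    (hγ : 0 ≤ γ)
    (hμγ : ∀ i, 1 ≤ i → i ≤ 2 * n → μ (2 * n) * ((i : ℝ) / (2 * n : ℕ)) ^ γ ≤ μ i)
    (hD : ∀ j < 2 * n, ∀ t ∈ Set.Icc 0 l, HasDerivAt (D j) (D (j + 1) t) t)
    (hDM : ∀ j ≤ 2 * n, ∀ t ∈ Set.Icc 0 l, |D j t| ≤ weightProd M0 μ j)
    (hj0 : j0 ≤ n) (hsum : exp 1 * l ≤ ∑ i ∈ Finset.Ioc j0 (2 * n), 1 / μ i)
    (h0 : exp (-(j0 : ℝ)) * M0 ≤ |D 0 0|)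
    (hA : A ⊆ Set.Ico 0 l) (hm : 0 < m) (hAm : ENNReal.ofReal m ≤ volume A)
    (hε : ∀ t ∈ A, |D 0 t| ≤ ε) :
    |D 0 0| ≤ (4 * exp (2 + γ) * l / m) ^ (2 * n) * ε := by
  have hml : m ≤ l := by
    have h1 := hAm.trans (measure_mono hA)
    rw [Real.volume_Ico, sub_zero] at h1
    by_contra! h
    exact absurd h1 (not_le.2 ((ENNReal.ofReal_lt_ofReal_iff hm).2 h))
  have hl : 0 < l := hm.trans_le hml
  have hn' : (1 : ℝ) ≤ n := by exact_mod_cast hn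
  obtain ⟨r, hr⟩ : ∃ r, 2 * n = r + 1 := ⟨2 * n - 1, by omega⟩
  have hε0 : 0 ≤ ε := by
    obtain ⟨y, hy⟩ : A.Nonempty := nonempty_of_measure_ne_zero
      ((ENNReal.ofReal_pos.2 hm).trans_le hAm).ne'
    exact (abs_nonneg _).trans (hε y hy)
  -- The constant sequence c meets the sum condition with equality; j0 ≤ n gives c ≥ n/(e l).
  set c : ℝ := ((2 * n : ℕ) - j0 : ℝ) / (exp 1 * l) with hc
  have hj0' : (j0 : ℝ) ≤ n := by exact_mod_cast hj0
  have hcn : (n : ℝ) / (exp 1 * l) ≤ c := by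
    rw [hc]; gcongr; push_cast; linarith
  have hcpos : 0 < c := lt_of_lt_of_le (by positivity) hcn
  -- Enlarging the weights keeps all derivative bounds. If μ_(2n) is below c, the constant sequence
  -- c replaces μ: the sum condition survives and the products ν_1⋯ν_j become large enough.
  obtain ⟨ν, hν, hνm, hμν, hνsum, hνprod⟩ : ∃ ν : ℕ → ℝ, (∀ j, 1 ≤ j → j ≤ r + 1 → 0 < ν j) ∧
      (∀ i j, 1 ≤ i → i ≤ j → j ≤ r + 1 → ν i ≤ ν j) ∧
      (∀ j, 1 ≤ j → j ≤ r + 1 → μ j ≤ ν j) ∧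
      exp 1 * l ≤ ∑ i ∈ Finset.Ioc j0 (r + 1), 1 / ν i ∧
      ∀ j ≤ r + 1, (n / (exp 1 * l)) ^ j * exp (-(γ * (2 * n : ℕ))) ≤
        ∏ i ∈ Finset.Icc 1 j, ν i := by
    rcases le_or_gt c (μ (2 * n)) with h | h
    · refine ⟨μ, fun j h1 _ => hμ j h1, fun i j h1 h2 _ => hμm i j h1 h2, fun _ _ _ => le_rfl,
        hr ▸ hsum, fun j hj => ?_⟩
      exact prod_weight_ge (by positivity) hγ (hcn.trans h) hμγ (hr ▸ hj)
    · refine ⟨fun _ => c, fun _ _ _ => hcpos, fun _ _ _ _ _ => le_rfl,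
        fun j h1 h2 => (hμm j _ h1 (hr ▸ h2)).trans h.le, ?_, fun j hj => ?_⟩
      · rw [Finset.sum_const, Nat.card_Ioc, nsmul_eq_mul, ← hr, Nat.cast_sub (by omega), hc]
        have : ((2 * n : ℕ) - j0 : ℝ) ≠ 0 := by push_cast; linarith
        field_simp
        exact le_rfl
      · rw [Finset.prod_const, Nat.card_Icc, Nat.add_sub_cancel]
        calc _ ≤ (n / (exp 1 * l)) ^ j * 1 := by
              gcongr
              exact exp_le_one_iff.2 (by simp only [Left.neg_nonpos_iff]; positivity)
          _ ≤ c ^ j := by rw [mul_one]; gcongr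
  -- With r = 2n - 1 gaps of size m/(2n), the total r s stays strictly below m.
  obtain ⟨j, hjr, hj⟩ := exists_weight_lt_of_small_on (s := m / (2 * n : ℕ)) (r := r) (j0 := j0)
    (l := l) (ε := ε) (D := D) hM hν hνm (fun j hj => hD j (hr ▸ hj))
    (fun j hj t ht => (hDM j (hr ▸ hj) t ht).trans <| by
      unfold weightProd
      gcongr with i hi
      · intro i hi
        rw [Finset.mem_Icc] at hi
        exact (hμ i hi.1).le
      · rw [Finset.mem_Icc] at hi
        exact hμν i hi.1 (hi.2.trans hj))
    (by omega) hνsum h0 hA (by positivity)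
    (lt_of_lt_of_le ((ENNReal.ofReal_lt_ofReal_iff hm).2 (by
      rw [mul_div_assoc', div_lt_iff₀ (by positivity), hr, mul_comm]
      push_cast; gcongr; linarith)) hAm) hε
  have hD0 : |D 0 0| ≤ M0 := (hDM 0 (by omega) 0 ⟨le_rfl, hl.le⟩).trans_eq (weightProd_zero _ _)
  refine hD0.trans ?_
  set q : ℕ := 2 * n with hq
  have h1 : exp ((j : ℝ) - q) * (M0 * ((n / (exp 1 * l)) ^ j * exp (-(γ * q)))) ≤
      ε * (2 / (m / q)) ^ r * l ^ (r - j) / (r - j).factorial := by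
    rw [← hr] at hj
    refine le_trans ?_ hj.le
    unfold weightProd
    have := hνprod j (by omega)
    gcongr
  have hqn : (q : ℝ) = 2 * n := by rw [hq]; push_cast; ring
  have hq0 : (0 : ℝ) < q := by rw [hqn]; linarith
  have h2 : M0 = exp (q + γ * q) * (l / n) ^ j *
      (exp ((j : ℝ) - q) * (M0 * ((n / (exp 1 * l)) ^ j * exp (-(γ * q))))) := by
    have e1 : exp (q + γ * q) * exp ((j : ℝ) - q) * exp (-(γ * q)) = exp 1 ^ j := by
      rw [← exp_add, ← exp_add, ← exp_nat_mul]; congr 1; ring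
    have e2 : (l / n) ^ j * (n / (exp 1 * l)) ^ j * exp 1 ^ j = 1 := by
      rw [← mul_pow, ← mul_pow]
      have : l / n * (n / (exp 1 * l)) * exp 1 = 1 := by field_simp
      rw [this, one_pow]
    calc M0 = M0 * ((l / n) ^ j * (n / (exp 1 * l)) ^ j * exp 1 ^ j) := by rw [e2, mul_one]
      _ = _ := by rw [← e1]; ring
  rw [h2]
  calc _ ≤ exp (q + γ * q) * (l / n) ^ j *
        (ε * (2 / (m / q)) ^ r * l ^ (r - j) / (r - j).factorial) := by gcongr
    _ = ε * exp (q + γ * q) * (2 * l / m) ^ r * 2 ^ j * ((q : ℝ) ^ (r - j) / (r - j).factorial) := by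
        obtain ⟨k, rfl⟩ : ∃ k, r = j + k := ⟨r - j, by omega⟩
        rw [Nat.add_sub_cancel_left, hqn]
        simp only [pow_add, mul_pow, div_pow]
        field_simp
    _ ≤ ε * exp (q + γ * q) * (2 * l / m) ^ r * 2 ^ r * exp q := by
        gcongr
        · norm_num
        · exact Real.pow_div_factorial_le_exp _ hq0.le _
    _ = ε * exp (2 + γ) ^ q * (4 * l / m) ^ r := by
        have : exp (2 + γ) ^ q = exp (q + γ * q) * exp q := by
          rw [← exp_add, ← exp_nat_mul]; congr 1; ring
        have h4 : (4 * l / m) ^ r = (2 * l / m) ^ r * 2 ^ r := by rw [← mul_pow]; congr 1; ring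
        rw [this, h4]; ring
    -- The exponent is raised from r to q = r + 1, which is allowed since m ≤ l.
    _ ≤ ε * exp (2 + γ) ^ q * (4 * l / m) ^ q := by
        gcongr
        · rw [le_div_iff₀ hm]; linarith
        · omega
    _ = _ := by
        rw [mul_assoc, ← mul_pow]; rw [mul_comm ε]; congr 2; ring

/-! ### Directional and partial derivatives -/

/-- The expansion of `(x_1 + ⋯ + x_d)^j` counts the words of length `j` of given content. -/
theorem card_words_of_content {d j : ℕ} {α : Fin d → ℕ} (hα : ∑ i, α i = j) :
    (Finset.univ.filter fun p : Fin j → Fin d =>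
      (fun i => (Finset.univ.filter fun k => p k = i).card) = α).card =
      Nat.multinomial Finset.univ α := by
  classical
  have h1 : (∑ i : Fin d, (MvPolynomial.X i : MvPolynomial (Fin d) ℕ)) ^ j =
      ∑ p : Fin j → Fin d, ∏ k, MvPolynomial.X (p k) := by
    rw [Fintype.sum_pow]
  rw [Finset.sum_pow_eq_sum_piAntidiag] at h1
  have hmon : ∀ (n : ℕ) (β : Fin d → ℕ),
      (n : MvPolynomial (Fin d) ℕ) * ∏ i, (MvPolynomial.X i : MvPolynomial (Fin d) ℕ) ^ β i =
      MvPolynomial.monomial (Finsupp.equivFunOnFinite.symm β) n := by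
    intro n β
    rw [MvPolynomial.monomial_eq, Finsupp.prod_fintype _ _ (by simp), eq_natCast MvPolynomial.C n]
    rfl
  have hmon1 : ∀ (β : Fin d → ℕ), ∏ i, (MvPolynomial.X i : MvPolynomial (Fin d) ℕ) ^ β i =
      MvPolynomial.monomial (Finsupp.equivFunOnFinite.symm β) 1 := by
    intro β
    simpa using hmon 1 β
  have hword : ∀ p : Fin j → Fin d, ∏ k, (MvPolynomial.X (p k) : MvPolynomial (Fin d) ℕ) =
      ∏ i, MvPolynomial.X i ^ (Finset.univ.filter fun k => p k = i).card := by
    intro p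
    rw [← Finset.prod_fiberwise_of_maps_to (s := Finset.univ) (t := Finset.univ) (g := p)
      (fun _ _ => Finset.mem_univ _)]
    refine Finset.prod_congr rfl fun i _ => ?_
    rw [Finset.prod_congr rfl (g := fun _ => (MvPolynomial.X i : MvPolynomial (Fin d) ℕ)),
      Finset.prod_const]
    intro k hk
    rw [(Finset.mem_filter.1 hk).2]
  simp only [hword, hmon] at h1
  simp only [hmon1] at h1
  have h2 := congrArg (MvPolynomial.coeff (Finsupp.equivFunOnFinite.symm α)) h1
  simp only [MvPolynomial.coeff_sum, MvPolynomial.coeff_monomial,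
    EmbeddingLike.apply_eq_iff_eq] at h2
  rw [Finset.card_filter, ← h2, Finset.sum_ite_eq_of_mem' _ _ _ (by simp [hα])]

/-- Two words of the same content differ by a permutation of the letters. -/
theorem exists_perm_of_content_eq {d j : ℕ} {p p' : Fin j → Fin d}
    (h : ∀ i, (Finset.univ.filter fun k => p k = i).card =
      (Finset.univ.filter fun k => p' k = i).card) : ∃ σ : Equiv.Perm (Fin j), p' ∘ σ = p := by
  have e : ∀ i, {k // p k = i} ≃ {k // p' k = i} := fun i =>
    Fintype.equivOfCardEq (by rw [Fintype.card_subtype, Fintype.card_subtype]; exact h i)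
  exact ⟨Equiv.ofFiberEquiv e, funext fun a => Equiv.ofFiberEquiv_map e a⟩

variable {E : Type*} [NormedAddCommGroup E] [NormedSpace ℝ E]

/-- Iterated derivatives of a `C^n` function are symmetric. -/
theorem iteratedFDeriv_comp_perm_of_contDiffOn {U : Set E} (hU : IsOpen U) {f : E → ℝ} (j : ℕ) :
    ContDiffOn ℝ j f U → ∀ x ∈ U, ∀ (v : Fin j → E) (σ : Equiv.Perm (Fin j)),
      iteratedFDeriv ℝ j f x (v ∘ σ) = iteratedFDeriv ℝ j f x v := by
  induction j with
  | zero => intro _ x _ v σ; congr 1; ext i; exact i.elim0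
  | succ j ih =>
    intro hf x hx v σ
    have hfj : ContDiffOn ℝ j f U := hf.of_le (by exact_mod_cast j.le_succ)
    have hdiff : ∀ y ∈ U, DifferentiableAt ℝ (iteratedFDeriv ℝ j f) y := fun y hy =>
      (hf.contDiffAt (hU.mem_nhds hy)).differentiableAt_iteratedFDeriv (by exact_mod_cast j.lt_succ_self)
    have htail : ∀ (w : Fin j → E) (τ : Equiv.Perm (Fin j)) (u : E),
        fderiv ℝ (iteratedFDeriv ℝ j f) x u (w ∘ τ) = fderiv ℝ (iteratedFDeriv ℝ j f) x u w := by
      intro w τ u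
      have h1 : ∀ w : Fin j → E, fderiv ℝ (iteratedFDeriv ℝ j f) x u w =
          fderiv ℝ (fun y => iteratedFDeriv ℝ j f y w) x u := by
        intro w
        rw [fderiv_continuousMultilinear_apply_const (hdiff x hx)]
        rfl
      rw [h1, h1]
      congr 1
      refine Filter.EventuallyEq.fderiv_eq ?_
      filter_upwards [hU.mem_nhds hx] with y hy using ih hfj y hy w τ
    -- Adjacent transpositions suffice. The first one is the symmetry of the second derivative of
    -- D^j f; the others act on the tail, where the symmetry holds on all of U by induction and so
    -- passes to the derivative.
    have hmem : σ ∈ Submonoid.closure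
        (Set.range fun i : Fin j => Equiv.swap i.castSucc i.succ) := by
      rw [Equiv.Perm.mclosure_swap_castSucc_succ]; trivial
    induction hmem using Submonoid.closure_induction generalizing v with
    | one => rfl
    | mul a b _ _ ha hb => rw [Equiv.Perm.coe_mul, ← Function.comp_assoc, hb, ha]
    | mem a ha =>
      obtain ⟨i, rfl⟩ := ha
      cases j with
      | zero => exact i.elim0
      | succ j =>
      cases i using Fin.cases with
      | zero =>
        have hsnd : ∀ w : Fin (j + 2) → E, iteratedFDeriv ℝ (j + 2) f x w =
            fderiv ℝ (fderiv ℝ (iteratedFDeriv ℝ j f)) x (w 0) (w 1) (Fin.tail (Fin.tail w)) := by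
          intro w
          have h := LinearIsometryEquiv.comp_fderiv (𝕜 := ℝ) (G := E)
            (E := E →L[ℝ] E [×j]→L[ℝ] ℝ) (F := E [×(j + 1)]→L[ℝ] ℝ)
            (iso := (continuousMultilinearCurryLeftEquiv ℝ (fun _ : Fin (j + 1) => E) ℝ).symm)
            (f := fderiv ℝ (iteratedFDeriv ℝ j f)) (x := x)
          rw [iteratedFDeriv_succ_apply_left, iteratedFDeriv_succ_eq_comp_left]
          exact congrArg (fun T => T (w 0) (Fin.tail w)) h
        have hsymm : IsSymmSndFDerivAt ℝ (iteratedFDeriv ℝ j f) x := by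
          have h2 : ContDiffAt ℝ 2 (iteratedFDeriv ℝ j f) x :=
            (hf.contDiffAt (hU.mem_nhds hx)).iteratedFDeriv_right (m := 2) (i := j)
              (by norm_cast; omega)
          exact h2.isSymmSndFDerivAt (by simp)
        rw [hsnd, hsnd]
        have e0 : (v ∘ Equiv.swap (Fin.castSucc 0) (Fin.succ 0)) 0 = v 1 := by simp
        have e1 : (v ∘ Equiv.swap (Fin.castSucc 0) (Fin.succ 0)) 1 = v 0 := by simp
        have e2 : Fin.tail (Fin.tail (v ∘ Equiv.swap (Fin.castSucc 0) (Fin.succ (0 : Fin (j + 1))))) =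
            Fin.tail (Fin.tail v) := by
          funext k
          simp only [Fin.tail, Function.comp]
          rw [Equiv.swap_apply_of_ne_of_ne]
          · simp
          · simp [Fin.ext_iff]
        rw [e0, e1, e2, hsymm.eq]
      | succ i =>
        rw [iteratedFDeriv_succ_apply_left, iteratedFDeriv_succ_apply_left]
        have e0 : (v ∘ Equiv.swap (Fin.castSucc (Fin.succ i)) (Fin.succ (Fin.succ i))) 0 = v 0 := by
          simp only [Function.comp]
          rw [Equiv.swap_apply_of_ne_of_ne] <;> simp [Fin.ext_iff]
        have e1 : Fin.tail (v ∘ Equiv.swap (Fin.castSucc (Fin.succ i)) (Fin.succ (Fin.succ i))) =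
            Fin.tail v ∘ Equiv.swap (Fin.castSucc i) (Fin.succ i) := by
          funext k
          simp only [Fin.tail, Function.comp]
          rw [← Fin.succ_castSucc, (Fin.succ_injective _).map_swap]
        rw [e0, e1, htail]

/-- Derivatives along a line. -/
theorem hasDerivAt_iteratedFDeriv_line {E : Type*} [NormedAddCommGroup E] [NormedSpace ℝ E]
    {U : Set E} (hU : IsOpen U) {f : E → ℝ} {n j : ℕ} (hf : ContDiffOn ℝ n f U) (hj : j < n)
    (x₀ v : E) (t : ℝ) (ht : x₀ + t • v ∈ U) :
    HasDerivAt (fun s : ℝ => iteratedFDeriv ℝ j f (x₀ + s • v) (fun _ => v))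
      (iteratedFDeriv ℝ (j + 1) f (x₀ + t • v) (fun _ => v)) t := by
  have h1 : HasFDerivAt (iteratedFDeriv ℝ j f) (fderiv ℝ (iteratedFDeriv ℝ j f) (x₀ + t • v))
      (x₀ + t • v) :=
    ((hf.contDiffAt (hU.mem_nhds ht)).differentiableAt_iteratedFDeriv
      (by exact_mod_cast hj)).hasFDerivAt
  have h2 : HasDerivAt (fun s : ℝ => x₀ + s • v) v t := by
    simpa using ((hasDerivAt_id t).smul_const v).const_add x₀
  have h3 := h1.comp_hasDerivAt t h2
  exact (ContinuousMultilinearMap.apply ℝ (fun _ : Fin j => E) ℝ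
    (fun _ => v)).hasFDerivAt.comp_hasDerivAt t h3

variable {d : ℕ}

theorem abs_le_supNorm {g : EuclideanSpace ℝ (Fin d) → ℝ} {S : Set (EuclideanSpace ℝ (Fin d))}
    (hS : BddAbove ((fun x => |g x|) '' S)) {x : EuclideanSpace ℝ (Fin d)} (hx : x ∈ S) :
    |g x| ≤ supNorm g S := le_csSup hS ⟨x, hx, rfl⟩

/-- By symmetry the order of the basis vectors is immaterial, so the particular word chosen in
`partialDeriv` can be replaced by any word with the same letters. -/
theorem partialDeriv_eq_of_content {U : Set (EuclideanSpace ℝ (Fin d))} (hU : IsOpen U)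
    {f : EuclideanSpace ℝ (Fin d) → ℝ} {j : ℕ} (hf : ContDiffOn ℝ j f U)
    {α : Fin d → ℕ} (hα : ∑ i, α i = j) {p : Fin j → Fin d}
    (hp : (fun i => (Finset.univ.filter fun k => p k = i).card) = α)
    {x : EuclideanSpace ℝ (Fin d)} (hx : x ∈ U) :
    partialDeriv α f x = iteratedFDeriv ℝ j f x (fun k => EuclideanSpace.single (p k) (1 : ℝ)) := by
  subst hα
  have hcontent : ∀ i, (Finset.univ.filter fun k => p k = i).card =
      (Finset.univ.filter fun k : Fin (∑ i, α i) => (finSigmaFinEquiv.symm k).1 = i).card := by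
    intro i
    rw [congrFun hp i, ← Fintype.card_subtype]
    have e : {k : Fin (∑ i, α i) // (finSigmaFinEquiv.symm k).1 = i} ≃ Fin (α i) :=
      (finSigmaFinEquiv.symm.subtypeEquiv (q := fun s => s.1 = i) (fun _ => Iff.rfl)).trans
        (Equiv.sigmaSubtype i)
    rw [Fintype.card_congr e, Fintype.card_fin]
  obtain ⟨σ, hσ⟩ := exists_perm_of_content_eq hcontent
  subst hσ
  exact (iteratedFDeriv_comp_perm_of_contDiffOn hU _ hf x hx
    (fun k => EuclideanSpace.single (finSigmaFinEquiv.symm k).1 (1 : ℝ)) σ).symm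

theorem continuousOn_iteratedFDeriv_apply {E : Type*} [NormedAddCommGroup E] [NormedSpace ℝ E]
    {U : Set E} (hU : IsOpen U) {f : E → ℝ} {j : ℕ} (hf : ContDiffOn ℝ j f U) (m : Fin j → E) :
    ContinuousOn (fun x => iteratedFDeriv ℝ j f x m) U := by
  intro x hx
  have h := (hf.contDiffAt (hU.mem_nhds hx)).iteratedFDeriv_right (m := 0) (i := j) (by simp)
  exact ((ContinuousMultilinearMap.apply ℝ (fun _ : Fin j => E) ℝ m).continuous.continuousAt.comp
    h.continuousAt).continuousWithinAt

/-- Directional derivatives are controlled by the weighted sum of the partial derivatives. -/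
theorem abs_iteratedFDeriv_le_derivNorm {K U : Set (EuclideanSpace ℝ (Fin d))} (hU : IsOpen U)
    (hK : IsCompact K) (hKU : K ⊆ U) {f : EuclideanSpace ℝ (Fin d) → ℝ} {j : ℕ}
    (hf : ContDiffOn ℝ j f U) {x v : EuclideanSpace ℝ (Fin d)} (hx : x ∈ K) (hv : ‖v‖ ≤ 1) :
    |iteratedFDeriv ℝ j f x (fun _ => v)| ≤ derivNorm j f K := by
  classical
  have hvsum : v = ∑ i, v i • EuclideanSpace.single i (1 : ℝ) := by
    ext k
    simp [Pi.single_apply]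
  have hvi : ∀ i, |v i| ≤ 1 := fun i => (PiLp.norm_apply_le v i).trans hv
  have hexp : iteratedFDeriv ℝ j f x (fun _ => v) = ∑ p : Fin j → Fin d,
      (∏ k, v (p k)) * iteratedFDeriv ℝ j f x (fun k => EuclideanSpace.single (p k) (1 : ℝ)) := by
    conv_lhs => rw [hvsum]
    rw [ContinuousMultilinearMap.map_sum]
    refine Finset.sum_congr rfl fun p _ => ?_
    rw [ContinuousMultilinearMap.map_smul_univ, smul_eq_mul]
  have h1 : |iteratedFDeriv ℝ j f x (fun _ => v)| ≤ ∑ p : Fin j → Fin d,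
      |iteratedFDeriv ℝ j f x (fun k => EuclideanSpace.single (p k) (1 : ℝ))| := by
    rw [hexp]
    refine (Finset.abs_sum_le_sum_abs _ _).trans (Finset.sum_le_sum fun p _ => ?_)
    rw [abs_mul]
    refine mul_le_of_le_one_left (abs_nonneg _) ?_
    rw [Finset.abs_prod]
    exact Finset.prod_le_one (fun _ _ => abs_nonneg _) (fun k _ => hvi _)
  refine h1.trans ?_
  -- Words are grouped by content α; each group has j!/α! members, all giving the same partial
  -- derivative.
  rw [← Finset.sum_fiberwise_of_maps_to (s := Finset.univ)
    (t := Finset.piAntidiag (Finset.univ : Finset (Fin d)) j)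
    (g := fun p i => (Finset.univ.filter fun k => p k = i).card)]
  · refine Finset.sum_le_sum fun α hα => ?_
    have hα' : ∑ i, α i = j := by simpa using hα
    have hmult : ((j.factorial : ℝ) / ∏ i, ((α i).factorial : ℝ)) =
        (Nat.multinomial Finset.univ α : ℝ) := by
      rw [div_eq_iff (by positivity), mul_comm, ← Nat.cast_prod, ← Nat.cast_mul,
        Nat.multinomial_spec, hα']
    rw [hmult, ← card_words_of_content hα', ← nsmul_eq_mul]
    refine Finset.sum_le_card_nsmul _ _ _ fun p hp => ?_
    rw [← partialDeriv_eq_of_content hU hf hα' (Finset.mem_filter.1 hp).2 (hKU hx)]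
    -- Boundedness must be checked, since `sSup` of an unbounded set of reals is 0.
    refine abs_le_supNorm ?_ hx
    refine (hK.image_of_continuousOn (ContinuousOn.abs ?_)).bddAbove
    refine ContinuousOn.mono ?_ hKU
    subst hα'
    exact continuousOn_iteratedFDeriv_apply hU hf _
  · intro p _
    rw [Finset.mem_piAntidiag]
    refine ⟨?_, fun i _ => Finset.mem_univ i⟩
    simpa using (Finset.card_eq_sum_card_fiberwise (f := p) (s := Finset.univ) (t := Finset.univ)
      (fun _ _ => Finset.mem_univ _)).symm

/-! ### Growth of the interpolating function -/

/-- Inside a piece, and at its right end point, the left derivative is the one-sided derivative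
of the piece. -/
theorem leftDeriv_eq_derivWithin {g : ℝ → ℝ} {a b s : ℝ} (ha : 1 ≤ a)
    (hg : ContDiffOn ℝ 1 g (Set.Icc a b)) (hs : s ∈ Set.Ioc a b) :
    leftDeriv g s = derivWithin g (Set.Icc a b) s := by
  have hs1 : s ≠ 1 := (ha.trans_lt hs.1).ne'
  rw [leftDeriv, if_neg hs1]
  have h1 : HasDerivWithinAt g (derivWithin g (Set.Icc a b) s) (Set.Icc a b) s :=
    ((hg.differentiableOn one_ne_zero) s ⟨hs.1.le, hs.2⟩).hasDerivWithinAt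
  have h2 := h1.mono (Set.Icc_subset_Icc_right hs.2)
  have h3 : Set.Icc a s ∈ nhdsWithin s (Set.Iic s) := Icc_mem_nhdsLE hs.1
  exact (h2.mono_of_mem_nhdsWithin h3).derivWithin (uniqueDiffOn_Iic s s Set.self_mem_Iic)

theorem hasDerivAt_leftDeriv {g : ℝ → ℝ} {a b s : ℝ} (ha : 1 ≤ a)
    (hg : ContDiffOn ℝ 1 g (Set.Icc a b)) (hs : s ∈ Set.Ioo a b) :
    HasDerivAt g (leftDeriv g s) s := by
  rw [leftDeriv_eq_derivWithin ha hg ⟨hs.1, hs.2.le⟩]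
  exact ((hg.differentiableOn one_ne_zero) s ⟨hs.1.le, hs.2.le⟩).hasDerivWithinAt.hasDerivAt
    (Icc_mem_nhds hs.1 hs.2)

variable {W : FullWeight} {g : ℝ → ℝ}

/-- On each closed piece the quotient, formed with the derivative within the piece, is continuous,
and [1, n] meets finitely many pieces. A breakpoint belongs to the piece on its left, in accordance
with the left derivative. Without this, the supremum would take its default value. -/
theorem FullWeight.IsInterpolation.bddAbove (hg : W.IsInterpolation g) (n : ℕ) :
    BddAbove ((fun s : ℝ => s * leftDeriv g s / g s) '' Set.Icc 1 (n : ℝ)) := by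
  obtain ⟨-, hcont, hpos, ⟨a, ha0, hamono, hatop, hC1⟩, -⟩ := hg
  have ha1 : ∀ k, 1 ≤ a k := fun k => ha0 ▸ hamono.monotone (Nat.zero_le k)
  have key : ∀ m, BddAbove ((fun s : ℝ => s * leftDeriv g s / g s) '' Set.Icc 1 (a m)) := by
    intro m
    induction m with
    | zero => rw [ha0, Set.Icc_self, Set.image_singleton]; exact bddAbove_singleton
    | succ m ih =>
      have hlt := hamono m.lt_succ_self
      have hc : ContinuousOn (fun s : ℝ => s * derivWithin g (Set.Icc (a m) (a (m + 1))) s / g s)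
          (Set.Icc (a m) (a (m + 1))) := by
        refine ContinuousOn.div (continuousOn_id.mul
          ((hC1 m).continuousOn_derivWithin (uniqueDiffOn_Icc hlt) le_rfl))
          (hcont.mono fun s hs => (ha1 m).trans hs.1)
          (fun s hs => (hpos s ((ha1 m).trans hs.1)).ne')
      have hb := (isCompact_Icc.image_of_continuousOn hc).bddAbove
      refine (ih.union hb).mono ?_
      rintro _ ⟨s, hs, rfl⟩
      rcases le_or_gt s (a m) with h | h
      · exact Or.inl ⟨s, ⟨hs.1, h⟩, rfl⟩
      · refine Or.inr ⟨s, ⟨h.le, hs.2⟩, ?_⟩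
        simp only
        rw [leftDeriv_eq_derivWithin (ha1 m) (hC1 m) ⟨h, hs.2⟩]
  obtain ⟨m, hm⟩ := (hatop.eventually_ge_atTop (n : ℝ)).exists
  exact (key m).mono (Set.image_mono (Set.Icc_subset_Icc_right hm))

theorem FullWeight.IsInterpolation.le_gammaConst (hg : W.IsInterpolation g) {n : ℕ} {s : ℝ}
    (hs : s ∈ Set.Icc 1 (n : ℝ)) : s * leftDeriv g s / g s ≤ gammaConst g n :=
  le_csSup (hg.bddAbove n) ⟨s, hs, rfl⟩

theorem FullWeight.IsInterpolation.gammaConst_nonneg (hg : W.IsInterpolation g) {n : ℕ}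
    (hn : 1 ≤ n) : 0 ≤ gammaConst g n := by
  have h1 : (1 : ℝ) ∈ Set.Icc 1 (n : ℝ) := ⟨le_rfl, by exact_mod_cast hn⟩
  refine le_trans ?_ (hg.le_gammaConst h1)
  have h2 : 0 ≤ leftDeriv g 1 := by
    rw [leftDeriv, if_pos rfl]
    exact hg.1.derivWithin_nonneg
  have h3 := hg.2.2.1 1 le_rfl
  positivity

/-- The logarithmic derivative bound, integrated. -/
theorem FullWeight.IsInterpolation.mul_rpow_le (hg : W.IsInterpolation g) {n i : ℕ} (hi : 1 ≤ i)
    (hin : i ≤ n) : W.μ n * ((i : ℝ) / n) ^ gammaConst g n ≤ W.μ i := by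
  have hγ := fun s hs => hg.le_gammaConst (n := n) (s := s) hs
  obtain ⟨-, hcont, hpos, ⟨a, ha0, hamono, hatop, hC1⟩, hμ⟩ := hg
  set γ := gammaConst g n
  have ha1 : ∀ k, 1 ≤ a k := fun k => ha0 ▸ hamono.monotone (Nat.zero_le k)
  have hi' : (1 : ℝ) ≤ i := by exact_mod_cast hi
  have hin' : (i : ℝ) ≤ n := by exact_mod_cast hin
  -- The claim at i is h n ≤ h i; h is decreasing on [1, n], as seen piece by piece.
  set h : ℝ → ℝ := fun s => Real.log (g s) - γ * Real.log s with hh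
  have hhc : ContinuousOn h (Set.Ici 1) := by
    refine (hcont.log fun s hs => (hpos s hs).ne').sub (continuousOn_const.mul
      (continuousOn_id.log fun s hs => ?_))
    exact (lt_of_lt_of_le one_pos hs).ne'
  have key : ∀ m, AntitoneOn h (Set.Icc 1 (min (a m) n)) := by
    intro m
    induction m with
    | zero =>
      intro x hx y hy _
      rw [ha0] at hx hy
      rw [le_antisymm (hx.2.trans (min_le_left _ _)) hx.1,
        le_antisymm (hy.2.trans (min_le_left _ _)) hy.1]
    | succ m ih =>
      have h1c : 1 ≤ min (a m) n := le_min (ha1 m) (hi'.trans hin')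
      have hcc : min (a m) (n : ℝ) ≤ min (a (m + 1)) n :=
        min_le_min_right _ (hamono m.lt_succ_self).le
      rw [← Set.Icc_union_Icc_eq_Icc h1c hcc]
      refine ih.union_right ?_ (isGreatest_Icc h1c) (isLeast_Icc hcc)
      have hd : ∀ s ∈ interior (Set.Icc (min (a m) (n : ℝ)) (min (a (m + 1)) n)),
          1 ≤ s ∧ s ≤ n ∧ HasDerivAt h (leftDeriv g s / g s - γ * s⁻¹) s := by
        intro s hs
        rw [interior_Icc] at hs
        have hsn : s < n := hs.2.trans_le (min_le_right _ _)
        have hsa : a m < s := (min_lt_iff.1 hs.1).resolve_right hsn.le.not_gt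
        have hs1 : 1 ≤ s := h1c.trans hs.1.le
        refine ⟨hs1, hsn.le, ?_⟩
        exact ((hasDerivAt_leftDeriv (ha1 m) (hC1 m)
          ⟨hsa, hs.2.trans_le (min_le_left _ _)⟩).log (hpos s hs1).ne').sub
          ((Real.hasDerivAt_log (by linarith)).const_mul γ)
      refine antitoneOn_of_deriv_nonpos (convex_Icc _ _)
        (hhc.mono fun s hs => h1c.trans hs.1)
        (fun s hs => (hd s hs).2.2.differentiableAt.differentiableWithinAt) (fun s hs => ?_)
      obtain ⟨hs1, hsn, hds⟩ := hd s hs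
      rw [hds.deriv]
      have h2 := hγ s ⟨hs1, hsn⟩
      have hs0 : 0 < s := by linarith
      have h3 : leftDeriv g s / g s ≤ γ * s⁻¹ := by
        rw [← div_eq_mul_inv, le_div_iff₀ hs0]
        calc _ = s * leftDeriv g s / g s := by ring
          _ ≤ γ := h2
      linarith
  obtain ⟨m, hm⟩ := (hatop.eventually_ge_atTop (n : ℝ)).exists
  have h1 := key m
  rw [min_eq_right hm] at h1
  have h2 := h1 ⟨hi', hin'⟩ ⟨hi'.trans hin', le_rfl⟩ hin'
  simp only [hh] at h2
  rw [hμ n (hi.trans hin), hμ i hi] at h2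
  have hμn := W.μ_pos n (hi.trans hin)
  have hμi := W.μ_pos i hi
  have hi0 : (0 : ℝ) < i := by linarith
  have hn0 : (0 : ℝ) < n := by linarith
  rw [← Real.log_le_log_iff (by positivity) hμi, Real.log_mul hμn.ne' (by positivity),
    Real.log_rpow (by positivity), Real.log_div hi0.ne' hn0.ne']
  linarith

/-! ### Polar coordinates and the choice of a ray -/

open Set Module Metric in
/-- Polar coordinates for the measure of a set. -/
theorem measure_eq_lintegral_polar {E : Type*} [NormedAddCommGroup E] [NormedSpace ℝ E]
    [FiniteDimensional ℝ E] [Nontrivial E] [MeasurableSpace E] [BorelSpace E] (μ : Measure E)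
    [μ.IsAddHaarMeasure] {A : Set E} (hA : MeasurableSet A) :
    μ A = ∫⁻ v : sphere (0 : E) 1, ∫⁻ r in {r : ℝ | 0 < r ∧ r • (v : E) ∈ A},
      ENNReal.ofReal (r ^ (finrank ℝ E - 1)) ∂volume ∂μ.toSphere := by
  set B : Set (sphere (0 : E) 1 × Ioi (0 : ℝ)) := {p | (p.2 : ℝ) • (p.1 : E) ∈ A} with hB
  have hBm : MeasurableSet B := by
    refine hA.preimage ?_
    exact (Continuous.smul (continuous_subtype_val.comp continuous_snd)
      (continuous_subtype_val.comp continuous_fst)).measurable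
  have hpre : homeomorphUnitSphereProd E ⁻¹' B = Subtype.val ⁻¹' A := by
    ext x
    have hx : (x : E) ≠ 0 := x.2
    simp [hB, smul_smul, hx]
  have h1 := μ.measurePreserving_homeomorphUnitSphereProd.measure_preimage hBm.nullMeasurableSet
  rw [hpre, comap_subtype_coe_apply (measurableSet_singleton _).compl,
    Subtype.image_preimage_coe, inter_comm, ← sdiff_eq, measure_sdiff_null (measure_singleton _),
    Measure.prod_apply hBm] at h1
  rw [h1]
  refine lintegral_congr fun v => ?_
  rw [Measure.volumeIoiPow, withDensity_apply _ (measurable_prodMk_left hBm),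
    setLIntegral_subtype measurableSet_Ioi _ fun a : ℝ ↦ ENNReal.ofReal (a ^ (finrank ℝ E - 1))]
  congr 2
  ext r
  simp [hB, and_comm]

open Set in
theorem setLIntegral_pow_Ioc {a b : ℝ} (k : ℕ) (ha : 0 ≤ a) (hab : a ≤ b) :
    ∫⁻ r in Ioc a b, ENNReal.ofReal (r ^ k) =
      ENNReal.ofReal ((b ^ (k + 1) - a ^ (k + 1)) / (k + 1)) := by
  rw [← ofReal_integral_eq_lintegral_ofReal, ← intervalIntegral.integral_of_le hab, integral_pow]
  · exact (intervalIntegral.intervalIntegrable_pow k).1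
  · filter_upwards [ae_restrict_mem measurableSet_Ioc] with r hr
    exact pow_nonneg (ha.trans hr.1.le) k

open Set in
/-- Among the subsets of given length of an interval `(0, l]`, the one at the far end has the
largest moments. -/
theorem setLIntegral_pow_le {T : Set ℝ} (hT : MeasurableSet T) {l c : ℝ} (k : ℕ) (hl : 0 ≤ l)
    (hc0 : 0 ≤ c) (hc1 : c ≤ 1) (hTl : T ⊆ Ioc 0 l) (hTc : volume T ≤ ENNReal.ofReal (c * l)) :
    ∫⁻ r in T, ENNReal.ofReal (r ^ k) ≤
      ENNReal.ofReal (1 - (1 - c) ^ (k + 1)) * ∫⁻ r in Ioc 0 l, ENNReal.ofReal (r ^ k) := by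
  set a := (1 - c) * l with ha
  have ha0 : 0 ≤ a := mul_nonneg (by linarith) hl
  have hal : a ≤ l := mul_le_of_le_one_left hl (by linarith)
  have hsplit : T = (T ∩ Iic a) ∪ (T ∩ Ioi a) := by
    rw [← inter_union_distrib_left, Iic_union_Ioi, inter_univ]
  have hfar : T ∩ Ioi a = Ioc a l ∩ T := by
    ext r; simp only [mem_inter_iff, mem_Ioi, mem_Ioc]
    exact ⟨fun h => ⟨⟨h.2, (hTl h.1).2⟩, h.1⟩, fun h => ⟨h.2, h.1.1⟩⟩
  -- Since (a, l] has length c l, the part of T below a fits, in measure, into the part of (a, l]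
  -- missed by T. The integrand is at most a^k on the former and at least a^k on the latter.
  have hvol : volume (T ∩ Iic a) ≤ volume (Ioc a l \ T) := by
    have h1 : volume (T ∩ Iic a) + volume (Ioc a l ∩ T) ≤
        volume (Ioc a l \ T) + volume (Ioc a l ∩ T) := by
      rw [add_comm (volume (Ioc a l \ T)), measure_inter_add_sdiff _ hT, ← hfar,
        ← measure_union ?_ (hT.inter measurableSet_Ioi), ← hsplit, Real.volume_Ioc]
      · exact hTc.trans_eq (by rw [ha]; congr 1; ring)
      · rw [Set.disjoint_left]
        exact fun r h1 h2 => not_lt.2 (show r ≤ a from h1.2) h2.2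
    refine (ENNReal.add_le_add_iff_right ?_).1 h1
    exact ((measure_mono inter_subset_left).trans_lt (by
      rw [Real.volume_Ioc]; exact ENNReal.ofReal_lt_top)).ne
  have hnear : ∫⁻ r in T ∩ Iic a, ENNReal.ofReal (r ^ k) ≤
      ∫⁻ r in Ioc a l \ T, ENNReal.ofReal (r ^ k) := by
    calc _ ≤ ∫⁻ _ in T ∩ Iic a, ENNReal.ofReal (a ^ k) := by
          refine setLIntegral_mono measurable_const fun r hr => ?_
          exact ENNReal.ofReal_le_ofReal (pow_le_pow_left₀ (hTl hr.1).1.le hr.2 k)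
      _ = ENNReal.ofReal (a ^ k) * volume (T ∩ Iic a) := setLIntegral_const _ _
      _ ≤ ENNReal.ofReal (a ^ k) * volume (Ioc a l \ T) := by gcongr
      _ = ∫⁻ _ in Ioc a l \ T, ENNReal.ofReal (a ^ k) := (setLIntegral_const _ _).symm
      _ ≤ _ := by
          refine setLIntegral_mono (by fun_prop) fun r hr => ?_
          exact ENNReal.ofReal_le_ofReal (pow_le_pow_left₀ ha0 hr.1.1.le k)
  calc ∫⁻ r in T, ENNReal.ofReal (r ^ k)
      ≤ (∫⁻ r in T ∩ Iic a, ENNReal.ofReal (r ^ k)) +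
          ∫⁻ r in T ∩ Ioi a, ENNReal.ofReal (r ^ k) := by
        conv_lhs => rw [hsplit]
        exact lintegral_union_le _ _ _
    _ ≤ (∫⁻ r in Ioc a l \ T, ENNReal.ofReal (r ^ k)) +
          ∫⁻ r in Ioc a l ∩ T, ENNReal.ofReal (r ^ k) := by rw [hfar]; gcongr
    _ = ∫⁻ r in Ioc a l, ENNReal.ofReal (r ^ k) := by
        rw [add_comm]; exact lintegral_inter_add_sdiff _ _ hT
    _ = _ := by
        rw [setLIntegral_pow_Ioc k ha0 hal, setLIntegral_pow_Ioc k le_rfl hl,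
          ← ENNReal.ofReal_mul]
        · congr 1
          rw [ha, mul_pow]; ring
        · exact sub_nonneg.2 (pow_le_one₀ (by linarith) (by linarith))

open Set in
/-- A set that fills a large part of a convex body fills a large part of some ray. -/
theorem exists_ray {d : ℕ} (hd : 1 ≤ d) {L A : Set (EuclideanSpace ℝ (Fin d))}
    (hLc : Convex ℝ L) (hLk : IsCompact L) {x₀ : EuclideanSpace ℝ (Fin d)} (hx₀ : x₀ ∈ L)
    (hA : MeasurableSet A) (hAL : A ⊆ L) {c : ℝ} (hc0 : 0 ≤ c) (hc1 : c ≤ 1)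
    (h : ENNReal.ofReal (1 - (1 - c) ^ d) * volume L < volume A) :
    ∃ (v : EuclideanSpace ℝ (Fin d)) (l : ℝ), ‖v‖ = 1 ∧ 0 ≤ l ∧ (∀ t ∈ Icc 0 l, x₀ + t • v ∈ L) ∧
      {t : ℝ | 0 < t ∧ x₀ + t • v ∈ A} ⊆ Ioc 0 l ∧
      ENNReal.ofReal (c * l) < volume {t : ℝ | 0 < t ∧ x₀ + t • v ∈ A} := by
  have : Nonempty (Fin d) := ⟨⟨0, hd⟩⟩
  have hfin : Module.finrank ℝ (EuclideanSpace ℝ (Fin d)) - 1 = d - 1 := by simp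
  have hline : ∀ v : EuclideanSpace ℝ (Fin d), Continuous fun t : ℝ => x₀ + t • v := fun v => by
    fun_prop
  have hslice : ∀ v : Metric.sphere (0 : EuclideanSpace ℝ (Fin d)) 1, ∃ l : ℝ, 0 ≤ l ∧
      (∀ t ∈ Icc 0 l, x₀ + t • (v : EuclideanSpace ℝ (Fin d)) ∈ L) ∧
      {t : ℝ | 0 < t ∧ x₀ + t • (v : EuclideanSpace ℝ (Fin d)) ∈ L} = Ioc 0 l := by
    intro v
    have hv : ‖(v : EuclideanSpace ℝ (Fin d))‖ = 1 := by simp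
    set S : Set ℝ := {t : ℝ | 0 ≤ t ∧ x₀ + t • (v : EuclideanSpace ℝ (Fin d)) ∈ L} with hS
    have h0S : (0 : ℝ) ∈ S := ⟨le_rfl, by simpa using hx₀⟩
    have hSb : BddAbove S := by
      refine ⟨Metric.diam L, fun t ht => ?_⟩
      have h1 := Metric.dist_le_diam_of_mem hLk.isBounded ht.2 hx₀
      simpa [dist_eq_norm, norm_smul, hv, abs_of_nonneg ht.1] using h1
    have hScl : IsClosed S := isClosed_Ici.inter (hLk.isClosed.preimage (hline v))
    have hmem := hScl.csSup_mem ⟨0, h0S⟩ hSb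
    have hall : ∀ t ∈ Icc 0 (sSup S), x₀ + t • (v : EuclideanSpace ℝ (Fin d)) ∈ L := by
      intro t ht
      rcases eq_or_lt_of_le (ht.1.trans ht.2) with h0 | hpos
      · have : t = 0 := le_antisymm (h0 ▸ ht.2) ht.1
        subst this; exact h0S.2
      · have h2 := hLc.add_smul_sub_mem hx₀ hmem.2 (t := t / sSup S)
          ⟨div_nonneg ht.1 hpos.le, div_le_one_of_le₀ ht.2 hpos.le⟩
        rw [add_sub_cancel_left, smul_smul, div_mul_cancel₀ _ hpos.ne'] at h2
        exact h2
    refine ⟨sSup S, hmem.1, hall, ?_⟩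
    ext t
    exact ⟨fun ht => ⟨ht.1, le_csSup hSb ⟨ht.1.le, ht.2⟩⟩, fun ht => ⟨ht.1, hall t ⟨ht.1.le, ht.2⟩⟩⟩
  choose l hl0 hlL hlS using hslice
  have hsub : ∀ v : Metric.sphere (0 : EuclideanSpace ℝ (Fin d)) 1,
      {t : ℝ | 0 < t ∧ x₀ + t • (v : EuclideanSpace ℝ (Fin d)) ∈ A} ⊆ Ioc 0 (l v) := fun v => by
    rw [← hlS v]; exact fun t ht => ⟨ht.1, hAL ht.2⟩
  by_contra! hcon
  have hle : ∀ v : Metric.sphere (0 : EuclideanSpace ℝ (Fin d)) 1,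
      volume {t : ℝ | 0 < t ∧ x₀ + t • (v : EuclideanSpace ℝ (Fin d)) ∈ A} ≤
        ENNReal.ofReal (c * l v) := fun v =>
    hcon v (l v) (by simp) (hl0 v) (hlL v) (hsub v)
  have hpolar : ∀ B : Set (EuclideanSpace ℝ (Fin d)), MeasurableSet B → volume B =
      ∫⁻ v : Metric.sphere (0 : EuclideanSpace ℝ (Fin d)) 1,
        ∫⁻ r in {r : ℝ | 0 < r ∧ x₀ + r • (v : EuclideanSpace ℝ (Fin d)) ∈ B},
        ENNReal.ofReal (r ^ (d - 1)) ∂volume ∂(volume : Measure _).toSphere := by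
    intro B hB
    rw [← measure_preimage_add volume x₀ B,
      measure_eq_lintegral_polar volume (hB.preimage (measurable_const_add x₀)), hfin]
    rfl
  -- If every ray failed, integrating the moment comparison with k = d - 1 over all directions would
  -- contradict `h`.
  refine absurd h (not_lt.2 ?_)
  rw [hpolar A hA, hpolar L hLk.measurableSet, ← lintegral_const_mul' _ _ ENNReal.ofReal_ne_top]
  refine lintegral_mono fun v => ?_
  rw [hlS v]
  have hmeas : MeasurableSet {t : ℝ | 0 < t ∧ x₀ + t • (v : EuclideanSpace ℝ (Fin d)) ∈ A} :=
    measurableSet_Ioi.inter (hA.preimage (hline v).measurable)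
  have h1 := setLIntegral_pow_le hmeas (d - 1) (hl0 v) hc0 hc1 (hsub v) (hle v)
  rwa [Nat.sub_add_cancel hd] at h1

/-! ### The associated integer and the level e^(-j₀) -/

/-- What the associated integer says about the weight sequence. -/
theorem IsAssociatedInteger.spec {W : FullWeight} {d : ℕ} {K : Set (EuclideanSpace ℝ (Fin d))}
    {b : ℝ} {N : ℕ} (hN : IsAssociatedInteger W K b N) (hN1 : N ≠ 1) :
    1 ≤ N - 1 ∧ jZero (b / (2 * W.M0)) ≤ N - 1 ∧
      Real.exp 1 * Metric.diam K ≤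
        ∑ i ∈ Finset.Ioc (jZero (b / (2 * W.M0))) (2 * (N - 1)), 1 / W.μ i := by
  unfold IsAssociatedInteger degree at hN
  set j0 := jZero (b / (2 * W.M0))
  set S : Set ℕ := {n : ℕ | ∑ j ∈ Finset.Icc (j0 + 1) n, 1 / (Metric.diam K * W.μ j) < Real.exp 1}
    with hS
  have hle : ∀ n ∈ S, n + 1 ≤ N := by
    intro n hn
    have h1 : (n : ℕ∞) ≤ sSup ((fun n : ℕ => (n : ℕ∞)) '' S) := le_sSup ⟨n, hn, rfl⟩
    have h2 : ((n + 1 : ℕ) : ℕ∞) ≤ N := by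
      rw [hN]; push_cast; gcongr
    exact_mod_cast h2
  have hj0S : j0 ∈ S := by
    simp only [hS, Set.mem_ofPred_eq]
    rw [Finset.Icc_eq_empty (by omega), Finset.sum_empty]
    exact Real.exp_pos 1
  have hj0 := hle j0 hj0S
  have hNS : N ∉ S := fun h => by have := hle N h; omega
  have hn : 1 ≤ N - 1 := by omega
  refine ⟨hn, by omega, ?_⟩
  simp only [hS, Set.mem_ofPred_eq, not_lt] at hNS
  -- For diameter 0 all terms are 1/0 = 0, and their sum could not reach e.
  rcases (Metric.diam_nonneg (s := K)).eq_or_lt with h0 | hpos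
  · simp only [← h0, zero_mul, div_zero, Finset.sum_const_zero] at hNS
    exact absurd hNS (not_le.2 (Real.exp_pos 1))
  · have h1 : ∑ j ∈ Finset.Icc (j0 + 1) N, 1 / (Metric.diam K * W.μ j) =
        (Metric.diam K)⁻¹ * ∑ j ∈ Finset.Icc (j0 + 1) N, 1 / W.μ j := by
      rw [Finset.mul_sum]
      exact Finset.sum_congr rfl fun i _ => by rw [one_div, mul_inv, one_div]
    rw [h1, le_inv_mul_iff₀ hpos, mul_comm] at hNS
    -- The sum up to N is already large enough, and N ≤ 2(N - 1) because N ≥ 2.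
    refine hNS.trans (Finset.sum_le_sum_of_subset_of_nonneg ?_ ?_)
    · intro i; simp only [Finset.mem_Icc, Finset.mem_Ioc]; omega
    · intro i hi _
      rw [Finset.mem_Ioc] at hi
      have := W.μ_pos i (by omega)
      positivity

/-- Since j₀ ≥ log (M_0/b), a maximum of at least b is above the level that Bang's estimate would
rule out. -/
theorem exp_neg_jZero_mul_le {W : FullWeight} {b : ℝ} (hb : 0 < b) :
    Real.exp (-(jZero (2 * b / (2 * W.M0)) : ℝ)) * W.M0 ≤ b := by
  have hM := W.M0_pos
  rw [mul_div_mul_left _ _ two_ne_zero]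
  have h1 : Real.log (b / W.M0)⁻¹ ≤ jZero (b / W.M0) := Nat.le_ceil _
  rw [Real.log_inv] at h1
  rw [← le_div_iff₀ hM, ← Real.le_log_iff_exp_le (by positivity)]
  linarith

end Remez

/-! ### The Remez inequality in dimension d -/

open Remez in
theorem mainTheorem4 (d : ℕ) (hd : 1 ≤ d) (W : Remez.FullWeight)
    (μt : ℝ → ℝ) (hμt : W.IsInterpolation μt)
    (K : Set (EuclideanSpace ℝ (Fin d))) (b : ℝ)
    (hadm : Remez.AdmissibleData W K (2 * b))
    (N : ℕ) (hN : Remez.IsAssociatedInteger W K (2 * b) N)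
    -- for `N = 1` the constant is `∞` by convention and nothing is claimed
    (hN1 : N ≠ 1)
    (f : EuclideanSpace ℝ (Fin d) → ℝ) (hf : W.IsSmooth ((2 * (N - 1) : ℕ) : ℕ∞) K f)
    (L : Set (EuclideanSpace ℝ (Fin d))) (hL : Remez.IsConvexBody L) (hLK : L ⊆ K)
    (hfL : b ≤ Remez.supNorm f L)
    (E : Set (EuclideanSpace ℝ (Fin d))) (hE : NullMeasurableSet E volume) (hEL : E ⊆ L)
    (hEpos : 0 < volume E) :
    Remez.supNorm f L ≤
      (Remez.GammaConst μt (2 * (N - 1)) * volume.real L ^ ((1 : ℝ) / d) /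
        (volume.real L ^ ((1 : ℝ) / d) - (volume.real L - volume.real E) ^ ((1 : ℝ) / d)))
          ^ (2 * (N - 1)) * Remez.supNorm f E := by
  obtain ⟨hn, hj0n, hsum⟩ := hN.spec hN1
  obtain ⟨⟨-, hKk, -⟩, hb2, -⟩ := hadm
  have hb : 0 < b := by linarith
  have hexp := exp_neg_jZero_mul_le (W := W) hb
  set n := N - 1
  set q := 2 * n with hq
  obtain ⟨⟨U, hUo, hKU, hfU⟩, hfM⟩ := hf
  have hfU' : ContDiffOn ℝ q f U := by exact_mod_cast hfU
  obtain ⟨hLc, hLk, hLi⟩ := hL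
  have hLne : L.Nonempty := hLi.mono interior_subset
  have hfc : ContinuousOn (fun x => |f x|) L :=
    (hfU'.continuousOn.mono (hLK.trans hKU)).abs
  have hLb : BddAbove ((fun x => |f x|) '' L) := (hLk.image_of_continuousOn hfc).bddAbove
  obtain ⟨x₀, hx₀, hmax⟩ := hLk.exists_isMaxOn hLne hfc
  have hsup : supNorm f L = |f x₀| := le_antisymm
    (csSup_le (hLne.image _) (by rintro _ ⟨y, hy, rfl⟩; exact hmax hy)) (abs_le_supNorm hLb hx₀)
  have hfE : ∀ x ∈ E, |f x| ≤ supNorm f E := fun x hx =>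
    abs_le_supNorm (hLb.mono (Set.image_mono hEL)) hx
  obtain ⟨A, hAE, hAm, hAE'⟩ := hE.exists_measurable_subset_ae_eq
  have hAvol : volume A = volume E := measure_congr hAE'
  set γ := gammaConst μt q with hγ
  have hγ0 : 0 ≤ γ := hμt.gammaConst_nonneg (by omega)
  have key : ∀ c : ℝ, 0 < c → c ≤ 1 → ENNReal.ofReal (1 - (1 - c) ^ d) * volume L < volume A →
      supNorm f L ≤ (GammaConst μt q / c) ^ q * supNorm f E := by
    intro c hc0 hc1 hc
    obtain ⟨v, l, hv, hl, hlL, hlA, hcl⟩ := exists_ray hd hLc hLk hx₀ hAm (hAE.trans hEL) hc0.le hc1 hc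
    set T := {t : ℝ | 0 < t ∧ x₀ + t • v ∈ A} with hT
    have hlpos : 0 < l := by
      by_contra! h
      rw [Set.Ioc_eq_empty (not_lt.2 h), Set.subset_empty_iff] at hlA
      rw [hlA, measure_empty] at hcl
      exact not_lt_zero hcl
    have hld : l ≤ Metric.diam K := by
      have h1 := Metric.dist_le_diam_of_mem hKk.isBounded (hLK (hlL l ⟨hl, le_rfl⟩)) (hLK hx₀)
      simpa [dist_eq_norm, norm_smul, hv, abs_of_nonneg hl] using h1
    -- The end point is dropped so that the set lies in the half-open interval required by
    -- `remez_one_dim`.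
    have hT' : volume (T \ {l}) = volume T := measure_sdiff_null (measure_singleton _)
    have hmain := remez_one_dim (D := fun j t => iteratedFDeriv ℝ j f (x₀ + t • v) (fun _ => v))
      (μ := W.μ) (M0 := W.M0) (l := l) (m := c * l) (ε := supNorm f E) (γ := γ) (n := n)
      (j0 := jZero (2 * b / (2 * W.M0))) (A := T \ {l}) hn W.M0_pos W.μ_pos W.μ_mono hγ0
      (fun i hi hin => hμt.mul_rpow_le hi hin)
      (fun j hj t ht => hasDerivAt_iteratedFDeriv_line hUo hfU' hj x₀ v t
        (hKU (hLK (hlL t ht))))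
      (fun j hj t ht => (abs_iteratedFDeriv_le_derivNorm hUo hKk hKU
        (hfU'.of_le (by exact_mod_cast hj)) (hLK (hlL t ht)) hv.le).trans
          (hfM j (by exact_mod_cast hj)))
      hj0n (le_trans (by gcongr) hsum)
      (by simpa using hexp.trans (hfL.trans_eq hsup))
      (fun t ht => ⟨(hlA ht.1).1.le, lt_of_le_of_ne (hlA ht.1).2 ht.2⟩)
      (by positivity) (hT' ▸ hcl.le)
      (fun t ht => by simpa using hfE _ (hAE ht.1.2))
    simp only [iteratedFDeriv_zero_apply, zero_smul, add_zero] at hmain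
    rw [hsup]
    refine hmain.trans ?_
    have hε : 0 ≤ supNorm f E := by
      obtain ⟨y, hy⟩ := nonempty_of_measure_ne_zero hEpos.ne'
      exact (abs_nonneg _).trans (hfE y hy)
    -- The length of the ray cancels; the resulting 4 e^(2+γ) is below the claimed 4 e^(4+γ).
    have e1 : 4 * Real.exp (2 + γ) * l / (c * l) = 4 * Real.exp (2 + γ) / c := by
      field_simp
    rw [e1]
    unfold GammaConst
    gcongr
    norm_num
  set VL := volume.real L with hVL
  set VE := volume.real E with hVE
  have hLfin : volume L ≠ ⊤ := hLk.measure_lt_top.ne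
  have hEfin : volume E ≠ ⊤ := ((measure_mono hEL).trans_lt hLk.measure_lt_top).ne
  have hVE0 : 0 < VE := ENNReal.toReal_pos hEpos.ne' hEfin
  have hVEL : VE ≤ VL := measureReal_mono hEL hLfin
  have hVL0 : 0 < VL := hVE0.trans_le hVEL
  have hd0 : d ≠ 0 := by omega
  set p := VL ^ ((1 : ℝ) / d) with hp
  set w := (VL - VE) ^ ((1 : ℝ) / d) with hw
  have hp0 : 0 < p := Real.rpow_pos_of_pos hVL0 _
  have hw0 : 0 ≤ w := Real.rpow_nonneg (by linarith) _
  have hpd : p ^ d = VL := by rw [hp, one_div, Real.rpow_inv_natCast_pow hVL0.le hd0]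
  have hwd : w ^ d = VL - VE := by
    rw [hw, one_div, Real.rpow_inv_natCast_pow (by linarith) hd0]
  have hwp : w < p := lt_of_pow_lt_pow_left₀ d hp0.le (by rw [hpd, hwd]; linarith)
  -- This is the c with 1 - (1 - c)^d = |E|/|L|. The choice of a ray needs strict inequality, hence
  -- c < cs, and the bound at cs follows by continuity.
  set cs := (p - w) / p with hcs
  have hcs0 : 0 < cs := div_pos (by linarith) hp0
  have hcs1 : cs ≤ 1 := by rw [hcs, div_le_one hp0]; linarith
  have hall : ∀ c ∈ Set.Ioo 0 cs, supNorm f L ≤ (GammaConst μt q / c) ^ q * supNorm f E := by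
    intro c hc
    refine key c hc.1 (hc.2.le.trans hcs1) ?_
    rw [hAvol, ← ENNReal.ofReal_toReal hLfin, ← ENNReal.ofReal_toReal hEfin]
    change ENNReal.ofReal _ * ENNReal.ofReal VL < ENNReal.ofReal VE
    rw [← ENNReal.ofReal_mul' hVL0.le, ENNReal.ofReal_lt_ofReal_iff hVE0]
    have h1 : w < (1 - c) * p := by
      have := hc.2
      rw [hcs, lt_div_iff₀ hp0] at this
      linarith
    have h2 : w ^ d < ((1 - c) * p) ^ d := pow_lt_pow_left₀ h1 hw0 hd0
    rw [hwd, mul_pow, hpd] at h2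
    linarith
  have hfinal : supNorm f L ≤ (GammaConst μt q / cs) ^ q * supNorm f E := by
    have hcont : ContinuousAt (fun c : ℝ => (GammaConst μt q / c) ^ q * supNorm f E) cs :=
      ((continuousAt_const.div continuousAt_id hcs0.ne').pow q).mul continuousAt_const
    refine ge_of_tendsto (hcont.tendsto.mono_left
      (nhdsWithin_le_nhds : nhdsWithin cs (Set.Iio cs) ≤ nhds cs)) ?_
    filter_upwards [Ioo_mem_nhdsLT hcs0] with c hc using hall c hc
  have e2 : GammaConst μt q / cs = GammaConst μt q * p / (p - w) := by
    rw [hcs, div_div_eq_mul_div]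
  rwa [e2] at hfinal
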